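/- Let $k$ be a field, $A$ an associative unital $k$-algebra and $A^e=A\otimes_k A^{op}$; a left $A^e$-module is the same as an $A$-bimodule on which $k$ acts centrally. For an $A^e$-module $M$, let $H^*(A,M)$ and $H_*(A,M)$ denote Hochschild cohomology and homology, i.e. the (co)homology of the standard complexes $C^p(A,M)=\mathrm{Hom}_k(A^{\otimes p},M)$ and $C_r(A,M)=M\otimes_k A^{\otimes r}$ with the Hochschild differentials, and set $H_n(A,M)=0$ for $n<0$. For $A^e$-modules $N,M$ the cap product $$\cap: H_r(A,N)\times H^p(A,M)\to H_{r-p}(A,N\otimes_A M)$$ is induced by $(n,a_1,\dots,a_r)\cap f=(-1)^{rp}\,(n\otimes_A f(a_1,\dots,a_p),a_{p+1},\dots,a_r)$. Suppose that $A$ has Van den Bergh duality of dimension $d\in\mathbb N$, that is: * $A$ is of type $FP$: as an $A^e$-module it has a resolution of finite length by finitely generated projective $A^e$-modules; * $A$ has cohomological dimension $d$: $\mathrm{pdim}_{A^e}(A)=d$; * $H^i(A,A^e)=0$ for all $i\neq d$; * the $A^e$-module $\mathcal D=H^d(A,A^e)$ (with the bimodule structure induced by right multiplication on $A^e$, namely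 $a\cdot(x\otimes y)\cdot b=xb\otimes ay$ on coefficients) is invertible: there is an $A^e$-module $E$ with $\mathcal D\otimes_A E\cong A\cong E\otimes_A\mathcal D$ as $A^e$-modules. Then there is a unique class $c\in H_d(A,\mathcal D)$, the fundamental class of $A$, such that the map $$c\cap-:\ \mathcal D=H^d(A,A^e)\to H_0(A,\mathcal D\otimes_A A^e)\cong\mathcal D$$ is the identity, where the identification is $[\delta\otimes(x\otimes y)]\mapsto y\,\delta\, x$. Moreover, for every $A^e$-module $M$ and every integer $p\ge 0$, the cap product $$c\cap-:\ H^p(A,M)\to H_{d-p}(A,\mathcal D\otimes_A M)$$ is an isomorphism; for $p>d$ this means that $H^p(A,M)=0$. -/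

import Mathlib

universe u

open scoped TensorProduct

noncomputable section

namespace Hochschild

/-! ## The enveloping algebra -/

section Enveloping

/-- The enveloping algebra `Aᵉ = A ⊗ₖ Aᵒᵖ`. A left `Aᵉ`-module `M` is an `A`-bimodule, with
`a · m = (a ⊗ 1) • m` and `m · a = (1 ⊗ aᵒᵖ) • m`. -/
abbrev Env (k A : Type*) [Field k] [Ring A] [Algebra k A] : Type _ := A ⊗[k] Aᵐᵒᵖ

variable (k A : Type*) [Field k] [Ring A] [Algebra k A]

/-- The linear map `x ⊗ yᵒᵖ ↦ y ⊗ xᵒᵖ` of `Aᵉ`, an involutive anti-automorphism. -/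
def Env.flip : Env k A →ₗ[k] Env k A :=
  (TensorProduct.comm k Aᵐᵒᵖ A).toLinearMap ∘ₗ
    TensorProduct.map (MulOpposite.opLinearEquiv k).toLinearMap
      (MulOpposite.opLinearEquiv k).symm.toLinearMap

@[simp] theorem Env.flip_tmul (x : A) (y : Aᵐᵒᵖ) :
    Env.flip k A (x ⊗ₜ y) = y.unop ⊗ₜ MulOpposite.op x := rfl

theorem Env.flip_one : Env.flip k A 1 = 1 := rfl

theorem Env.flip_mul (u v : Env k A) :
    Env.flip k A (u * v) = Env.flip k A v * Env.flip k A u := by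
  induction u using TensorProduct.induction_on with
  | zero => simp
  | add u₁ u₂ h₁ h₂ => simp only [add_mul, mul_add, map_add, h₁, h₂]
  | tmul x y =>
    induction v using TensorProduct.induction_on with
    | zero => simp
    | add u₁ u₂ h₁ h₂ => simp only [add_mul, mul_add, map_add, h₁, h₂]
    | tmul x' y' => simp

/-- The left action of `A` on an `Aᵉ`-module: `a · m = (a ⊗ 1) • m`. -/
def leftAct (M : Type*) [AddCommGroup M] [Module k M] [Module (Env k A) M]
    [IsScalarTower k (Env k A) M] : A →ₐ[k] Module.End k M :=
  (Algebra.lsmul k k M : Env k A →ₐ[k] Module.End k M).comp Algebra.TensorProduct.includeLeft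

/-- The right action of `A` on an `Aᵉ`-module: `m · a = (1 ⊗ aᵒᵖ) • m`. -/
def rightAct (M : Type*) [AddCommGroup M] [Module k M] [Module (Env k A) M]
    [IsScalarTower k (Env k A) M] : Aᵐᵒᵖ →ₐ[k] Module.End k M :=
  (Algebra.lsmul k k M : Env k A →ₐ[k] Module.End k M).comp Algebra.TensorProduct.includeRight

section
variable {k A}
variable {M : Type*} [AddCommGroup M] [Module k M] [Module (Env k A) M]
    [IsScalarTower k (Env k A) M]

theorem leftAct_apply (a : A) (m : M) :
    leftAct k A M a m = (a ⊗ₜ[k] (1 : Aᵐᵒᵖ) : Env k A) • m := rfl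

theorem rightAct_apply (a : Aᵐᵒᵖ) (m : M) :
    rightAct k A M a m = ((1 : A) ⊗ₜ[k] a : Env k A) • m := rfl

theorem leftAct_rightAct (a : A) (b : Aᵐᵒᵖ) (m : M) :
    leftAct k A M a (rightAct k A M b m) = (a ⊗ₜ[k] b : Env k A) • m := by
  simp [leftAct_apply, rightAct_apply, smul_smul]

theorem rightAct_leftAct (a : A) (b : Aᵐᵒᵖ) (m : M) :
    rightAct k A M b (leftAct k A M a m) = (a ⊗ₜ[k] b : Env k A) • m := by
  simp [leftAct_apply, rightAct_apply, smul_smul]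

end

/-- The algebra `A` itself, as an `Aᵉ`-module. -/
def Regular (k A : Type*) [Field k] [Ring A] [Algebra k A] : Type _ := A

instance : AddCommGroup (Regular k A) := inferInstanceAs (AddCommGroup A)
instance : Module k (Regular k A) := inferInstanceAs (Module k A)

/-- `(x ⊗ yᵒᵖ) • a = x a y`. -/
instance : Module (Env k A) (Regular k A) := instModuleTensorProductMop k A

theorem Regular.smul_def (x : A) (y : Aᵐᵒᵖ) (a : A) :
    ((x ⊗ₜ[k] y : Env k A) • (show Regular k A from a) : Regular k A) =
      (x * a * y.unop : A) :=
  AlgHom.mulLeftRight_apply k A x y a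

end Enveloping

/-! ## The tensor product over `A` of two bimodules -/

section BTensor

variable (k A : Type*) [Field k] [Ring A] [Algebra k A]
variable (M N : Type*)
  [AddCommGroup M] [Module k M] [Module (Env k A) M] [IsScalarTower k (Env k A) M]
  [AddCommGroup N] [Module k N] [Module (Env k A) N] [IsScalarTower k (Env k A) N]

/-- The relations `m · a ⊗ n - m ⊗ a · n` defining `M ⊗_A N` as a quotient of `M ⊗ₖ N`. -/
def BTensor.relations : Submodule k (M ⊗[k] N) :=
  Submodule.span k {t | ∃ (m : M) (a : A) (n : N),
    t = rightAct k A M (MulOpposite.op a) m ⊗ₜ[k] n - m ⊗ₜ[k] leftAct k A N a n}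

/-- The tensor product `M ⊗_A N` of two `A`-bimodules. -/
def BTensor : Type _ := (M ⊗[k] N) ⧸ BTensor.relations k A M N

namespace BTensor

instance : AddCommGroup (BTensor k A M N) :=
  inferInstanceAs (AddCommGroup ((M ⊗[k] N) ⧸ BTensor.relations k A M N))
instance : Module k (BTensor k A M N) :=
  inferInstanceAs (Module k ((M ⊗[k] N) ⧸ BTensor.relations k A M N))

/-- The projection `M ⊗ₖ N → M ⊗_A N`. -/
def proj : M ⊗[k] N →ₗ[k] BTensor k A M N := (relations k A M N).mkQ

theorem proj_surjective : Function.Surjective (proj k A M N) :=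
  Submodule.mkQ_surjective _

variable {M N} in
theorem proj_balanced (m : M) (a : A) (n : N) :
    proj k A M N (rightAct k A M (MulOpposite.op a) m ⊗ₜ[k] n) =
      proj k A M N (m ⊗ₜ[k] leftAct k A N a n) := by
  rw [← sub_eq_zero, ← map_sub]
  exact (Submodule.Quotient.mk_eq_zero _).2 (Submodule.subset_span ⟨m, a, n, rfl⟩)

variable {k A M N} in
/-- The universal property of `M ⊗_A N`. -/
def lift {P : Type*} [AddCommGroup P] [Module k P] (f : M ⊗[k] N →ₗ[k] P)
    (hf : ∀ (m : M) (a : A) (n : N),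
      f (rightAct k A M (MulOpposite.op a) m ⊗ₜ[k] n) = f (m ⊗ₜ[k] leftAct k A N a n)) :
    BTensor k A M N →ₗ[k] P :=
  (relations k A M N).liftQ f (by
    refine Submodule.span_le.2 ?_
    rintro _ ⟨m, a, n, rfl⟩
    simp [hf])

variable {k A M N} in
@[simp] theorem lift_proj {P : Type*} [AddCommGroup P] [Module k P] (f : M ⊗[k] N →ₗ[k] P)
    (hf : ∀ (m : M) (a : A) (n : N),
      f (rightAct k A M (MulOpposite.op a) m ⊗ₜ[k] n) = f (m ⊗ₜ[k] leftAct k A N a n))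
    (t : M ⊗[k] N) : lift f hf (proj k A M N t) = f t := rfl

variable {k A M N} in
theorem hom_ext {P : Type*} [AddCommGroup P] [Module k P] {f g : BTensor k A M N →ₗ[k] P}
    (h : ∀ (m : M) (n : N), f (proj k A M N (m ⊗ₜ n)) = g (proj k A M N (m ⊗ₜ n))) : f = g := by
  ext t
  obtain ⟨t, rfl⟩ := proj_surjective k A M N t
  exact LinearMap.congr_fun (TensorProduct.ext' (g := f ∘ₗ proj k A M N)
    (h := g ∘ₗ proj k A M N) h) t

/-- The left action `a · (m ⊗ n) = (a · m) ⊗ n`. -/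
def left : A →ₐ[k] Module.End k (BTensor k A M N) :=
  AlgHom.ofLinearMap
    { toFun a := lift (proj k A M N ∘ₗ (leftAct k A M a).rTensor N) (fun m b n ↦ by
        simp only [LinearMap.comp_apply, LinearMap.rTensor_tmul, leftAct_rightAct]
        rw [← rightAct_leftAct, proj_balanced])
      map_add' a b := hom_ext fun m n ↦ by simp [LinearMap.rTensor_add]
      map_smul' r a := hom_ext fun m n ↦ by simp }
    (hom_ext fun m n ↦ by simp)
    (fun a b ↦ hom_ext fun m n ↦ by simp)

/-- The right action `(m ⊗ n) · a = m ⊗ (n · a)`. -/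
def right : Aᵐᵒᵖ →ₐ[k] Module.End k (BTensor k A M N) :=
  AlgHom.ofLinearMap
    { toFun a := lift (proj k A M N ∘ₗ (rightAct k A N a).lTensor M) (fun m b n ↦ by
        simp only [LinearMap.comp_apply, LinearMap.lTensor_tmul, rightAct_leftAct]
        rw [← leftAct_rightAct, proj_balanced])
      map_add' a b := hom_ext fun m n ↦ by simp
      map_smul' r a := hom_ext fun m n ↦ by simp }
    (hom_ext fun m n ↦ by simp)
    (fun a b ↦ hom_ext fun m n ↦ by simp)

/-- The action of `Aᵉ` on `M ⊗_A N`: `(a ⊗ bᵒᵖ) • (m ⊗ n) = (a · m) ⊗ (n · b)`. -/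
def act : Env k A →ₐ[k] Module.End k (BTensor k A M N) :=
  Algebra.TensorProduct.lift (left k A M N) (right k A M N) (fun a b ↦ hom_ext fun m n ↦ by
    simp [left, right])

instance : Module (Env k A) (BTensor k A M N) := Module.compHom _ (act k A M N).toRingHom

instance : IsScalarTower k (Env k A) (BTensor k A M N) :=
  ⟨fun r u x ↦ by
    change act k A M N (r • u) x = r • act k A M N u x
    simp⟩

variable {M N} in
theorem smul_proj (a : A) (b : Aᵐᵒᵖ) (m : M) (n : N) :
    (a ⊗ₜ[k] b : Env k A) • proj k A M N (m ⊗ₜ n) =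
      proj k A M N (leftAct k A M a m ⊗ₜ rightAct k A N b n) := by
  change act k A M N (a ⊗ₜ b) _ = _
  simp [act, left, right]

end BTensor

end BTensor

/-! ## Operations on tensor powers -/

section TensorPowers

variable (k A : Type*) [Field k] [Ring A] [Algebra k A]

theorem contractNth_update {n : ℕ} (j : Fin n) (a : Fin (n + 1) → A) (i : Fin (n + 1)) :
    ∃ (i' : Fin n) (g : A →ₗ[k] A), ∀ x : A,
      Fin.contractNth j.castSucc (· * ·) (Function.update a i x) =
        Function.update (Fin.contractNth j.castSucc (· * ·) a) i' (g x) := by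
  rcases lt_trichotomy (i : ℕ) (j : ℕ) with hij | hij | hij
  · refine ⟨⟨i, by omega⟩, LinearMap.id, fun x ↦ funext fun l ↦ ?_⟩
    simp only [Fin.contractNth, Function.update_apply, Fin.ext_iff, Fin.val_castSucc,
      Fin.val_succ, LinearMap.id_apply]
    split_ifs <;> first | rfl | omega
  · refine ⟨j, LinearMap.mulRight k (a j.succ), fun x ↦ funext fun l ↦ ?_⟩
    rcases eq_or_ne l j with rfl | hl
    · simp [Fin.contractNth, Function.update_apply, Fin.ext_iff, hij]
    · have : (l : ℕ) ≠ j := fun h ↦ hl (Fin.ext h)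
      simp only [Fin.contractNth, Function.update_apply, Fin.ext_iff, Fin.val_castSucc,
        Fin.val_succ]
      split_ifs <;> first | rfl | omega
  · rcases eq_or_ne (i : ℕ) (j + 1) with hij' | hij'
    · refine ⟨j, LinearMap.mulLeft k (a j.castSucc), fun x ↦ funext fun l ↦ ?_⟩
      rcases eq_or_ne l j with rfl | hl
      · simp [Fin.contractNth, Function.update_apply, Fin.ext_iff, hij']
      · have : (l : ℕ) ≠ j := fun h ↦ hl (Fin.ext h)
        simp only [Fin.contractNth, Function.update_apply, Fin.ext_iff, Fin.val_castSucc,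
          Fin.val_succ]
        split_ifs <;> first | rfl | omega
    · refine ⟨⟨i - 1, by omega⟩, LinearMap.id, fun x ↦ funext fun l ↦ ?_⟩
      simp only [Fin.contractNth, Function.update_apply, Fin.ext_iff, Fin.val_castSucc,
        Fin.val_succ, LinearMap.id_apply]
      split_ifs <;> first | rfl | omega

/-- `a₀ ⊗ ⋯ ⊗ aₙ ↦ a₀ ⊗ ⋯ ⊗ aⱼ aⱼ₊₁ ⊗ ⋯ ⊗ aₙ`, for `0 ≤ j < n`. -/
def contract {n : ℕ} (j : Fin n) : (⨂[k]^(n + 1) A) →ₗ[k] (⨂[k]^n A) :=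
  PiTensorProduct.lift
    { toFun a := PiTensorProduct.tprod k (Fin.contractNth j.castSucc (· * ·) a)
      map_update_add' a i x y := by
        rename_i inst
        obtain rfl := Subsingleton.elim inst (instDecidableEqFin _)
        obtain ⟨i', g, h⟩ := contractNth_update k A j a i
        simp [h]
      map_update_smul' a i c x := by
        rename_i inst
        obtain rfl := Subsingleton.elim inst (instDecidableEqFin _)
        obtain ⟨i', g, h⟩ := contractNth_update k A j a i
        simp [h] }

@[simp] theorem contract_tprod {n : ℕ} (j : Fin n) (a : Fin (n + 1) → A) :
    contract k A j (PiTensorProduct.tprod k a) =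
      PiTensorProduct.tprod k (Fin.contractNth j.castSucc (· * ·) a) := by
  simp [contract]

/-- `a₀ ⊗ ⋯ ⊗ aₙ ↦ a₀ ⊗ (a₁ ⊗ ⋯ ⊗ aₙ)`. -/
def splitFirst (n : ℕ) : (⨂[k]^(n + 1) A) →ₗ[k] A ⊗[k] (⨂[k]^n A) :=
  PiTensorProduct.lift (LinearMap.uncurryLeft
    { toFun a := (TensorProduct.mk k A (⨂[k]^n A) a).compMultilinearMap (PiTensorProduct.tprod k)
      map_add' a b := by ext; simp
      map_smul' r a := by ext; simp [TensorProduct.smul_tmul'] })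

@[simp] theorem splitFirst_tprod {n : ℕ} (a : Fin (n + 1) → A) :
    splitFirst k A n (PiTensorProduct.tprod k a) =
      a 0 ⊗ₜ PiTensorProduct.tprod k (Fin.tail a) := by
  simp [splitFirst]

/-- `a₀ ⊗ ⋯ ⊗ aₙ ↦ (a₀ ⊗ ⋯ ⊗ aₙ₋₁) ⊗ aₙ`. -/
def splitLast (n : ℕ) : (⨂[k]^(n + 1) A) →ₗ[k] (⨂[k]^n A) ⊗[k] A :=
  PiTensorProduct.lift (MultilinearMap.uncurryRight
    ((TensorProduct.mk k (⨂[k]^n A) A).compMultilinearMap (PiTensorProduct.tprod k)))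

@[simp] theorem splitLast_tprod {n : ℕ} (a : Fin (n + 1) → A) :
    splitLast k A n (PiTensorProduct.tprod k a) =
      PiTensorProduct.tprod k (Fin.init a) ⊗ₜ a (Fin.last n) := by
  simp [splitLast]

/-- The isomorphism `A^{⊗ r} ≃ A^{⊗ p} ⊗ A^{⊗ q}`, for `p + q = r`. -/
def split {p q r : ℕ} (h : p + q = r) : (⨂[k]^r A) ≃ₗ[k] (⨂[k]^p A) ⊗[k] (⨂[k]^q A) :=
  (TensorPower.cast k A h.symm).trans TensorPower.mulEquiv.symm

theorem split_tprod {p q r : ℕ} (h : p + q = r) (a : Fin r → A) :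
    split k A h (PiTensorProduct.tprod k a) =
      PiTensorProduct.tprod k (fun i ↦ a (Fin.cast h (Fin.castAdd q i))) ⊗ₜ
        PiTensorProduct.tprod k (fun i ↦ a (Fin.cast h (Fin.natAdd p i))) := by
  subst h
  rw [← LinearEquiv.eq_symm_apply]
  simp only [split, TensorPower.mulEquiv, LinearEquiv.trans_symm, LinearEquiv.symm_symm,
    LinearEquiv.trans_apply, PiTensorProduct.tmulEquiv_apply, PiTensorProduct.reindex_tprod,
    TensorPower.cast_symm, TensorPower.cast_tprod]
  congr 1
  funext i
  refine Fin.addCases (fun i ↦ ?_) (fun i ↦ ?_) i <;> simp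

variable {k A} in
theorem chain_hom_ext {N P : Type*} [AddCommGroup N] [Module k N] [AddCommGroup P] [Module k P]
    {r : ℕ} {F G : N ⊗[k] (⨂[k]^r A) →ₗ[k] P}
    (h : ∀ (n : N) (a : Fin r → A),
      F (n ⊗ₜ PiTensorProduct.tprod k a) = G (n ⊗ₜ PiTensorProduct.tprod k a)) : F = G := by
  refine TensorProduct.ext
    (LinearMap.ext fun n ↦ PiTensorProduct.ext (MultilinearMap.ext fun a ↦ ?_))
  exact h n a

end TensorPowers

/-! ## Hochschild homology and cohomology -/

section Complexes

variable (k A : Type*) [Field k] [Ring A] [Algebra k A]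
variable (M : Type*) [AddCommGroup M] [Module k M] [Module (Env k A) M] [IsScalarTower k (Env k A) M]

/-- `a ⊗ m ↦ a · m`. -/
def leftMul : A ⊗[k] M →ₗ[k] M := TensorProduct.lift (leftAct k A M).toLinearMap

/-- `m ⊗ a ↦ m · a`. -/
def rightMul : M ⊗[k] A →ₗ[k] M :=
  TensorProduct.lift
    ((rightAct k A M).toLinearMap ∘ₗ (MulOpposite.opLinearEquiv k).toLinearMap).flip

@[simp] theorem leftMul_tmul (a : A) (m : M) :
    leftMul k A M (a ⊗ₜ m) = leftAct k A M a m := rfl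

@[simp] theorem rightMul_tmul (a : A) (m : M) :
    rightMul k A M (m ⊗ₜ a) = rightAct k A M (MulOpposite.op a) m := rfl

/-- Hochschild chains `C_n(A, M) = M ⊗ₖ A^{⊗ n}`. -/
abbrev Chain (n : ℕ) : Type _ := M ⊗[k] (⨂[k]^n A)

/-- Hochschild cochains `Cⁿ(A, M) = Homₖ(A^{⊗ n}, M)`. -/
abbrev Cochain (n : ℕ) : Type _ := (⨂[k]^n A) →ₗ[k] M

/-- The face `(m, a₀, …, aₙ) ↦ (m · a₀, a₁, …, aₙ)`. -/
def faceFirst (n : ℕ) : Chain k A M (n + 1) →ₗ[k] Chain k A M n :=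
  (rightMul k A M).rTensor (⨂[k]^n A) ∘ₗ
    (TensorProduct.assoc k M A (⨂[k]^n A)).symm.toLinearMap ∘ₗ (splitFirst k A n).lTensor M

/-- The face `(m, a₀, …, aₙ) ↦ (aₙ · m, a₀, …, aₙ₋₁)`. -/
def faceLast (n : ℕ) : Chain k A M (n + 1) →ₗ[k] Chain k A M n :=
  (leftMul k A M).rTensor (⨂[k]^n A) ∘ₗ
    (TensorProduct.assoc k A M (⨂[k]^n A)).symm.toLinearMap ∘ₗ
    (TensorProduct.comm k (M ⊗[k] (⨂[k]^n A)) A).toLinearMap ∘ₗ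
    (TensorProduct.assoc k M (⨂[k]^n A) A).symm.toLinearMap ∘ₗ (splitLast k A n).lTensor M

/-- The Hochschild boundary `b : C_{n+1}(A, M) → C_n(A, M)`. -/
def boundary (n : ℕ) : Chain k A M (n + 1) →ₗ[k] Chain k A M n :=
  faceFirst k A M n
    + ∑ j : Fin n, (-1 : k) ^ ((j : ℕ) + 1) • (contract k A j).lTensor M
    + (-1 : k) ^ (n + 1) • faceLast k A M n

theorem boundary_tprod (n : ℕ) (m : M) (a : Fin (n + 1) → A) :
    boundary k A M n (m ⊗ₜ PiTensorProduct.tprod k a) =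
      rightAct k A M (MulOpposite.op (a 0)) m ⊗ₜ PiTensorProduct.tprod k (Fin.tail a)
      + ∑ j : Fin n, (-1 : k) ^ ((j : ℕ) + 1) •
          (m ⊗ₜ PiTensorProduct.tprod k (Fin.contractNth j.castSucc (· * ·) a))
      + (-1 : k) ^ (n + 1) •
          (leftAct k A M (a (Fin.last n)) m ⊗ₜ PiTensorProduct.tprod k (Fin.init a)) := by
  simp [boundary, faceFirst, faceLast]

/-- The Hochschild coboundary `b : Cⁿ(A, M) → Cⁿ⁺¹(A, M)`. -/
def coboundary (n : ℕ) : Cochain k A M n →ₗ[k] Cochain k A M (n + 1) where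
  toFun f :=
    leftMul k A M ∘ₗ f.lTensor A ∘ₗ splitFirst k A n
      + ∑ j : Fin n, (-1 : k) ^ ((j : ℕ) + 1) • (f ∘ₗ contract k A j)
      + (-1 : k) ^ (n + 1) • (rightMul k A M ∘ₗ f.rTensor A ∘ₗ splitLast k A n)
  map_add' f g := by
    simp only [LinearMap.lTensor_add, LinearMap.rTensor_add, LinearMap.add_comp,
      LinearMap.comp_add, smul_add, Finset.sum_add_distrib]
    abel
  map_smul' r f := by
    simp only [LinearMap.lTensor_smul, LinearMap.rTensor_smul, LinearMap.smul_comp,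
      LinearMap.comp_smul, smul_add, Finset.smul_sum, RingHom.id_apply, smul_comm r]

theorem coboundary_tprod (n : ℕ) (f : Cochain k A M n) (a : Fin (n + 1) → A) :
    coboundary k A M n f (PiTensorProduct.tprod k a) =
      leftAct k A M (a 0) (f (PiTensorProduct.tprod k (Fin.tail a)))
      + ∑ j : Fin n, (-1 : k) ^ ((j : ℕ) + 1) •
          f (PiTensorProduct.tprod k (Fin.contractNth j.castSucc (· * ·) a))
      + (-1 : k) ^ (n + 1) •
          rightAct k A M (MulOpposite.op (a (Fin.last n)))
            (f (PiTensorProduct.tprod k (Fin.init a))) := by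
  simp [coboundary]

/-- Hochschild cycles. -/
def cycles : (n : ℕ) → Submodule k (Chain k A M n)
  | 0 => ⊤
  | n + 1 => LinearMap.ker (boundary k A M n)

/-- Hochschild boundaries. -/
def boundaries (n : ℕ) : Submodule k (Chain k A M n) := LinearMap.range (boundary k A M n)

/-- Hochschild cocycles. -/
def cocycles (n : ℕ) : Submodule k (Cochain k A M n) := LinearMap.ker (coboundary k A M n)

/-- Hochschild coboundaries. -/
def coboundaries : (n : ℕ) → Submodule k (Cochain k A M n)
  | 0 => ⊥
  | n + 1 => LinearMap.range (coboundary k A M n)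

/-- Hochschild homology `H_n(A, M)`. -/
abbrev Homology (n : ℕ) : Type _ :=
  cycles k A M n ⧸ (boundaries k A M n).submoduleOf (cycles k A M n)

/-- Hochschild cohomology `Hⁿ(A, M)`. -/
abbrev Cohomology (n : ℕ) : Type _ :=
  cocycles k A M n ⧸ (coboundaries k A M n).submoduleOf (cocycles k A M n)

end Complexes

/-! ## The cap product -/

section Cap

variable {k A : Type*} [Field k] [Ring A] [Algebra k A]
variable {N M : Type*}
  [AddCommGroup N] [Module k N] [Module (Env k A) N] [IsScalarTower k (Env k A) N]
  [AddCommGroup M] [Module k M] [Module (Env k A) M] [IsScalarTower k (Env k A) M]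

/-- `n ⊗ (s ⊗ t) ↦ (n ⊗_A f(s)) ⊗ t`. -/
def capAux {p q : ℕ} (f : Cochain k A M p) :
    N ⊗[k] ((⨂[k]^p A) ⊗[k] (⨂[k]^q A)) →ₗ[k] Chain k A (BTensor k A N M) q :=
  (BTensor.proj k A N M ∘ₗ f.lTensor N).rTensor (⨂[k]^q A) ∘ₗ
    (TensorProduct.assoc k N (⨂[k]^p A) (⨂[k]^q A)).symm.toLinearMap

@[simp] theorem capAux_tmul {p q : ℕ} (f : Cochain k A M p) (n : N) (s : ⨂[k]^p A)
    (t : ⨂[k]^q A) :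
    capAux f (n ⊗ₜ (s ⊗ₜ t)) = BTensor.proj k A N M (n ⊗ₜ f s) ⊗ₜ t := rfl

theorem capAux_add {p q : ℕ} (f g : Cochain k A M p) :
    (capAux (f + g) : N ⊗[k] ((⨂[k]^p A) ⊗[k] (⨂[k]^q A)) →ₗ[k] _) = capAux f + capAux g := by
  simp [capAux, LinearMap.lTensor_add, LinearMap.comp_add, LinearMap.rTensor_add,
    LinearMap.add_comp]

theorem capAux_smul {p q : ℕ} (c : k) (f : Cochain k A M p) :
    (capAux (c • f) : N ⊗[k] ((⨂[k]^p A) ⊗[k] (⨂[k]^q A)) →ₗ[k] _) = c • capAux f := by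
  simp [capAux, LinearMap.lTensor_smul, LinearMap.comp_smul, LinearMap.rTensor_smul,
    LinearMap.smul_comp]

/-- The cap product of chains and cochains: for `p + q = r`,
`(n, a₁, …, a_r) ∩ f = (-1)^{rp} (n ⊗_A f(a₁, …, a_p), a_{p+1}, …, a_r)`. -/
def capChain {p q r : ℕ} (h : p + q = r) :
    Chain k A N r →ₗ[k] Cochain k A M p →ₗ[k] Chain k A (BTensor k A N M) q :=
  LinearMap.mk₂ k (fun z f ↦ (-1 : k) ^ (r * p) • capAux f ((split k A h).toLinearMap.lTensor N z))
    (fun z z' f ↦ by simp)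
    (fun c z f ↦ by simp [smul_comm c])
    (fun z f g ↦ by simp [capAux_add])
    (fun c z f ↦ by simp [capAux_smul, smul_comm c])

theorem capChain_tprod {p q r : ℕ} (h : p + q = r) (n : N) (a : Fin r → A)
    (f : Cochain k A M p) :
    capChain h (n ⊗ₜ PiTensorProduct.tprod k a) f =
      (-1 : k) ^ (r * p) •
        (BTensor.proj k A N M
          (n ⊗ₜ f (PiTensorProduct.tprod k fun i ↦ a (Fin.cast h (Fin.castAdd q i)))) ⊗ₜ
        PiTensorProduct.tprod k (fun i ↦ a (Fin.cast h (Fin.natAdd p i)))) := by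
  change (-1 : k) ^ (r * p) • capAux f ((split k A h).toLinearMap.lTensor N
    (n ⊗ₜ PiTensorProduct.tprod k a)) = _
  rw [LinearMap.lTensor_tmul, LinearEquiv.coe_coe, split_tprod,
    capAux_tmul]

theorem rightAct_proj (a : Aᵐᵒᵖ) (n : N) (m : M) :
    rightAct k A (BTensor k A N M) a (BTensor.proj k A N M (n ⊗ₜ m)) =
      BTensor.proj k A N M (n ⊗ₜ rightAct k A M a m) := by
  rw [rightAct_apply, BTensor.smul_proj]; simp

theorem leftAct_proj (a : A) (n : N) (m : M) :
    leftAct k A (BTensor k A N M) a (BTensor.proj k A N M (n ⊗ₜ m)) =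
      BTensor.proj k A N M (leftAct k A N a n ⊗ₜ m) := by
  rw [leftAct_apply, BTensor.smul_proj]; simp

/-- The Leibniz rule for the cap product. -/
theorem capChain_leibniz {p q r : ℕ} (h : p + q = r) (h₁ : p + 1 + q = r + 1)
    (h₂ : p + (q + 1) = r + 1) (z : Chain k A N (r + 1)) (f : Cochain k A M p) :
    capChain h (boundary k A N r z) f =
      (-1 : k) ^ (q + 1) • capChain h₁ z (coboundary k A M p f)
        + boundary k A (BTensor k A N M) q (capChain h₂ z f) := by
  subst h
  suffices H : (capChain rfl).flip f ∘ₗ boundary k A N (p + q) =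
      (-1 : k) ^ (q + 1) • (capChain h₁).flip (coboundary k A M p f)
        + boundary k A (BTensor k A N M) q ∘ₗ (capChain h₂).flip f from
    LinearMap.congr_fun H z
  refine chain_hom_ext fun n a ↦ ?_
  -- the first `p + 1` and the last `q + 1` entries of `a`
  set x : Fin (p + 1) → A := fun i ↦ a (Fin.cast h₁ (Fin.castAdd q i)) with hx
  set y : Fin (q + 1) → A := fun i ↦ a (Fin.natAdd p i) with hy
  have hy' (i : Fin (q + 1)) : a (Fin.natAdd p i) = y i := rfl
  have e₁ : (fun i : Fin p ↦ Fin.tail a (Fin.castAdd q i)) = Fin.tail x := by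
    funext i; simp only [Fin.tail, hx]; congr 1
  have e₂ : (fun i : Fin q ↦ Fin.tail a (Fin.natAdd p i)) = Fin.tail y := by
    funext i; simp only [Fin.tail, hy]; congr 1
  have e₃ : (fun i : Fin p ↦ Fin.init a (Fin.castAdd q i)) = Fin.init x := by
    funext i; simp only [Fin.init, hx]; congr 1
  have e₄ : (fun i : Fin q ↦ Fin.init a (Fin.natAdd p i)) = Fin.init y := by
    funext i; simp only [Fin.init, hy]; congr 1
  have e₅ (j : Fin p) : (fun i : Fin p ↦
      Fin.contractNth (Fin.castAdd q j).castSucc (· * ·) a (Fin.castAdd q i)) =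
      Fin.contractNth j.castSucc (· * ·) x := by
    funext i; simp only [Fin.contractNth, hx]; congr 1
  have e₆ (j : Fin p) : (fun i : Fin q ↦
      Fin.contractNth (Fin.castAdd q j).castSucc (· * ·) a (Fin.natAdd p i)) = Fin.tail y := by
    funext i
    rw [Fin.contractNth_apply_of_gt _ _ _ _ (by simp; omega)]
    simp only [Fin.tail, hy]; congr 1
  have e₇ (j : Fin q) : (fun i : Fin p ↦
      Fin.contractNth (Fin.natAdd p j).castSucc (· * ·) a (Fin.castAdd q i)) = Fin.init x := by
    funext i
    rw [Fin.contractNth_apply_of_lt _ _ _ _ (by simp; omega)]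
    simp only [Fin.init, hx]; congr 1
  have e₈ (j : Fin q) : (fun i : Fin q ↦
      Fin.contractNth (Fin.natAdd p j).castSucc (· * ·) a (Fin.natAdd p i)) =
      Fin.contractNth j.castSucc (· * ·) y := by
    funext i
    rcases lt_trichotomy (i : ℕ) j with h | h | h
    · rw [Fin.contractNth_apply_of_lt _ _ _ _ (by simpa using h),
        Fin.contractNth_apply_of_lt _ _ _ _ (by simpa using h)]
      simp only [hy]; congr 1
    · rw [Fin.contractNth_apply_of_eq _ _ _ _ (by simpa using h),
        Fin.contractNth_apply_of_eq _ _ _ _ (by simpa using h)]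
      simp only [hy]; congr 1
    · rw [Fin.contractNth_apply_of_gt _ _ _ _ (by simpa using h),
        Fin.contractNth_apply_of_gt _ _ _ _ (by simpa using h)]
      simp only [hy]; congr 1
  have e₉ : (fun i : Fin p ↦ a (Fin.castAdd (q + 1) i)) = Fin.init x := by
    funext i; simp only [Fin.init, hx]; congr 1
  have e₁₀ : (fun i : Fin q ↦ a (Fin.cast h₁ (Fin.natAdd (p + 1) i))) = Fin.tail y := by
    funext i; simp only [Fin.tail, hy]; congr 1; ext; simp; omega
  have e₁₁ : a 0 = x 0 := by simp only [hx]; congr 1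
  have e₁₂ : a (Fin.last (p + q)) = y (Fin.last q) := by simp only [hy]; congr 1
  have e₁₃ : x (Fin.last p) = y 0 := by simp only [hx, hy]; congr 1
  have s₁ : (-1 : k) ^ ((p + q + 1) * (p + 1)) =
      (-1) ^ ((p + q) * p) * ((-1) ^ p * (-1) ^ q * (-1) ^ p * (-1)) := by ring
  have s₂ : (-1 : k) ^ ((p + q + 1) * p) = (-1) ^ ((p + q) * p) * (-1) ^ p := by ring
  have s₃ (j : ℕ) : (-1 : k) ^ (p + j + 1) = (-1) ^ p * (-1) ^ (j + 1) := by ring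
  simp only [LinearMap.add_apply, LinearMap.smul_apply, LinearMap.comp_apply,
    LinearMap.flip_apply, boundary_tprod, capChain_tprod, map_add, map_smul, map_sum,
    coboundary_tprod, Fin.sum_univ_add, Fin.cast_refl, id, e₁, e₂, e₃, e₄,
    e₅, e₆, e₇, e₈, e₉, e₁₀, e₁₁, e₁₂, e₁₃, ← hx, hy', TensorProduct.tmul_add,
    TensorProduct.tmul_sum, TensorProduct.tmul_smul, TensorProduct.add_tmul,
    TensorProduct.sum_tmul, ← TensorProduct.smul_tmul', rightAct_proj, leftAct_proj,
    BTensor.proj_balanced, Fin.val_castAdd, Fin.val_natAdd, s₁, s₂, s₃, mul_smul]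
  simp only [smul_comm _ ((-1 : k) ^ ((p + q) * p)), ← smul_add, ← Finset.smul_sum]
  generalize (-1 : k) ^ ((p + q) * p) = s
  simp only [pow_succ (-1 : k) p, pow_succ (-1 : k) q]
  congr 1
  rcases neg_one_pow_eq_or k p with hp | hp <;> rcases neg_one_pow_eq_or k q with hq | hq <;>
    rw [hp, hq] <;> module

/-! ### The cap product in homology -/

theorem mem_cycles_zero (z : Chain k A M 0) : z ∈ cycles k A M 0 := trivial

theorem mem_cycles_succ {r : ℕ} {z : Chain k A M (r + 1)} :
    z ∈ cycles k A M (r + 1) ↔ boundary k A M r z = 0 := Iff.rfl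

theorem capChain_mem_cycles {p q r : ℕ} (h : p + q = r) {z : Chain k A N r}
    (hz : z ∈ cycles k A N r) {f : Cochain k A M p} (hf : f ∈ cocycles k A M p) :
    capChain h z f ∈ cycles k A (BTensor k A N M) q := by
  cases q with
  | zero => trivial
  | succ q =>
    subst h
    have hz' : boundary k A N (p + q) z = 0 := hz
    have hf' : coboundary k A M p f = 0 := hf
    have := capChain_leibniz rfl (by omega) rfl z f
    rw [hz', hf'] at this
    simpa [mem_cycles_succ] using this.symm

theorem capChain_mem_boundaries_left {p q r : ℕ} (h : p + q = r) {z : Chain k A N r}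
    (hz : z ∈ boundaries k A N r) {f : Cochain k A M p} (hf : f ∈ cocycles k A M p) :
    capChain h z f ∈ boundaries k A (BTensor k A N M) q := by
  obtain ⟨w, rfl⟩ := hz
  have hf' : coboundary k A M p f = 0 := hf
  have := capChain_leibniz h (by omega) (by omega) w f
  rw [hf', map_zero, smul_zero, zero_add] at this
  exact ⟨_, this.symm⟩

theorem capChain_mem_boundaries_right {p q r : ℕ} (h : p + q = r) {z : Chain k A N r}
    (hz : z ∈ cycles k A N r) {f : Cochain k A M p} (hf : f ∈ coboundaries k A M p) :
    capChain h z f ∈ boundaries k A (BTensor k A N M) q := by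
  cases p with
  | zero =>
    obtain rfl : f = 0 := hf
    simp
  | succ p =>
    obtain ⟨g, rfl⟩ := hf
    obtain ⟨r, rfl⟩ : ∃ r', r = r' + 1 := ⟨p + q, by omega⟩
    have hz' : boundary k A N r z = 0 := hz
    have := capChain_leibniz (q := q) (by omega) h (by omega) z g
    rw [hz', map_zero, LinearMap.zero_apply] at this
    have h' : capChain h z (coboundary k A M p g) =
        (-1 : k) ^ q • boundary k A (BTensor k A N M) q
          (capChain (q := q + 1) (by omega) z g) := by
      rcases neg_one_pow_eq_or k q with hq | hq <;>
        simp [pow_succ, hq] at this ⊢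
      · exact (sub_eq_zero.1 (by rw [sub_eq_add_neg, add_comm]; exact this.symm)).symm
      · exact eq_neg_of_add_eq_zero_left this.symm
    rw [h']
    exact Submodule.smul_mem _ _ ⟨_, rfl⟩

/-- The cap product `∩ : H_r(A, N) × H^p(A, M) → H_q(A, N ⊗_A M)`, where `p + q = r`. -/
def cap {p q r : ℕ} (h : p + q = r) :
    Homology k A N r →ₗ[k] Cohomology k A M p →ₗ[k] Homology k A (BTensor k A N M) q :=
  Submodule.liftQ _
    { toFun z := Submodule.mapQ _ _
        ((capChain h z.1).restrict fun _ hf ↦ capChain_mem_cycles h z.2 hf)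
        (fun f hf ↦ capChain_mem_boundaries_right h z.2 hf)
      map_add' z z' := by
        refine Submodule.linearMap_qext _ (LinearMap.ext fun f ↦ ?_)
        exact congrArg Submodule.Quotient.mk (Subtype.ext (by simp))
      map_smul' c z := by
        refine Submodule.linearMap_qext _ (LinearMap.ext fun f ↦ ?_)
        exact congrArg Submodule.Quotient.mk (Subtype.ext (by simp)) }
    (fun z hz ↦ by
      refine LinearMap.mem_ker.2 (Submodule.linearMap_qext _ (LinearMap.ext fun f ↦ ?_))
      exact (Submodule.Quotient.mk_eq_zero _).2 (capChain_mem_boundaries_left h hz f.2))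

theorem cap_mk {p q r : ℕ} (h : p + q = r) (z : cycles k A N r) (f : cocycles k A M p) :
    cap h (Submodule.Quotient.mk z) (Submodule.Quotient.mk f) =
      Submodule.Quotient.mk ⟨capChain h z.1 f.1, capChain_mem_cycles h z.2 f.2⟩ := rfl

end Cap

/-! ## Functoriality of cohomology and the dualizing module -/

section Dualizing

section Map

variable {k A : Type*} [Field k] [Ring A] [Algebra k A]
variable {M M' : Type*}
  [AddCommGroup M] [Module k M] [Module (Env k A) M] [IsScalarTower k (Env k A) M]
  [AddCommGroup M'] [Module k M'] [Module (Env k A) M'] [IsScalarTower k (Env k A) M']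

theorem coboundary_comp (φ : M →ₗ[Env k A] M') (n : ℕ) (f : Cochain k A M n) :
    coboundary k A M' n (φ.restrictScalars k ∘ₗ f) =
      φ.restrictScalars k ∘ₗ coboundary k A M n f := by
  refine PiTensorProduct.ext (MultilinearMap.ext fun a ↦ ?_)
  simp only [LinearMap.compMultilinearMap_apply, LinearMap.comp_apply, coboundary_tprod, map_add,
    map_sum, map_smul]
  simp [leftAct_apply, rightAct_apply]

/-- The map `Hⁿ(A, M) → Hⁿ(A, M')` induced by an `Aᵉ`-linear map `M → M'`. -/
def Cohomology.map (φ : M →ₗ[Env k A] M') (n : ℕ) :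
    Cohomology k A M n →ₗ[k] Cohomology k A M' n :=
  Submodule.mapQ _ _
    ((LinearMap.compRight k (φ.restrictScalars k)).restrict fun f hf ↦ by
      have hf' : coboundary k A M n f = 0 := hf
      change coboundary k A M' n (φ.restrictScalars k ∘ₗ f) = 0
      rw [coboundary_comp, hf', LinearMap.comp_zero])
    (by
      rintro ⟨f, hf⟩ hf'
      cases n with
      | zero =>
        obtain rfl : f = 0 := hf'
        exact LinearMap.comp_zero _
      | succ n =>
        obtain ⟨g, rfl⟩ := hf'
        exact ⟨φ.restrictScalars k ∘ₗ g, coboundary_comp φ n g⟩)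

theorem Cohomology.hom_ext {P : Type*} [AddCommGroup P] [Module k P] {n : ℕ}
    {F G : Cohomology k A M n →ₗ[k] P}
    (h : ∀ f : cocycles k A M n, F (Submodule.Quotient.mk f) = G (Submodule.Quotient.mk f)) :
    F = G :=
  Submodule.linearMap_qext _ (LinearMap.ext h)

theorem Cohomology.map_id (n : ℕ) :
    Cohomology.map (LinearMap.id : M →ₗ[Env k A] M) n = LinearMap.id :=
  Cohomology.hom_ext fun _ ↦ rfl

theorem Cohomology.map_comp {M'' : Type*} [AddCommGroup M''] [Module k M''] [Module (Env k A) M'']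
    [IsScalarTower k (Env k A) M''] (ψ : M' →ₗ[Env k A] M'') (φ : M →ₗ[Env k A] M') (n : ℕ) :
    Cohomology.map (ψ ∘ₗ φ) n = Cohomology.map ψ n ∘ₗ Cohomology.map φ n :=
  Cohomology.hom_ext fun _ ↦ rfl

theorem Cohomology.map_add (φ ψ : M →ₗ[Env k A] M') (n : ℕ) :
    Cohomology.map (φ + ψ) n = Cohomology.map φ n + Cohomology.map ψ n :=
  Cohomology.hom_ext fun _ ↦ rfl

theorem Cohomology.map_smul (c : k) (φ ψ : M →ₗ[Env k A] M') (n : ℕ) (h : ∀ m, ψ m = c • φ m) :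
    Cohomology.map ψ n = c • Cohomology.map φ n :=
  Cohomology.hom_ext fun f ↦
    congrArg Submodule.Quotient.mk (Subtype.ext (LinearMap.ext fun x ↦ h (f.1 x)))

end Map

variable (k A : Type*) [Field k] [Ring A] [Algebra k A]

/-- The `Aᵉ`-linear endomorphism `x ↦ x * flip u` of `Aᵉ`. -/
def mulFlip (u : Env k A) : Env k A →ₗ[Env k A] Env k A :=
  LinearMap.toSpanSingleton (Env k A) (Env k A) (Env.flip k A u)

theorem mulFlip_apply (u x : Env k A) : mulFlip k A u x = x * Env.flip k A u := rfl

/-- The action of `Aᵉ` on `Hⁿ(A, Aᵉ)` induced by the endomorphisms `x ↦ x * flip u` of `Aᵉ`, so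
that `a · (x ⊗ yᵒᵖ) · b = x b ⊗ (a y)ᵒᵖ` on coefficients. -/
def cohomologyAct (n : ℕ) : Env k A →ₐ[k] Module.End k (Cohomology k A (Env k A) n) :=
  AlgHom.ofLinearMap
    { toFun u := Cohomology.map (mulFlip k A u) n
      map_add' u v := by
        rw [← Cohomology.map_add]
        congr 1
        refine LinearMap.ext fun x ↦ ?_
        simp [mulFlip_apply, mul_add]
      map_smul' r u := Cohomology.map_smul r _ _ n fun m ↦ by
        rw [mulFlip_apply, mulFlip_apply, LinearMap.map_smul]
        exact Algebra.mul_smul_comm r m _ }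
    (by
      have : mulFlip k A 1 = LinearMap.id := by
        refine LinearMap.ext fun x ↦ ?_
        simp [mulFlip_apply, Env.flip_one]
      simp only [LinearMap.coe_mk, AddHom.coe_mk, this, Cohomology.map_id]
      rfl)
    (fun u v ↦ by
      have : mulFlip k A (u * v) = mulFlip k A u ∘ₗ mulFlip k A v := by
        refine LinearMap.ext fun x ↦ ?_
        simp [mulFlip_apply, Env.flip_mul, mul_assoc]
      simp only [LinearMap.coe_mk, AddHom.coe_mk, this, Cohomology.map_comp]
      rfl)

/-- The dualizing module `𝒟 = H^d(A, Aᵉ)`: here `Aᵉ` is a left module over itself, and its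
right multiplications induce the `Aᵉ`-module structure of `𝒟`. -/
def Dualizing (d : ℕ) : Type _ := Cohomology k A (Env k A) d

namespace Dualizing

variable (d : ℕ)

instance : AddCommGroup (Dualizing k A d) :=
  inferInstanceAs (AddCommGroup (Cohomology k A (Env k A) d))
instance : Module k (Dualizing k A d) :=
  inferInstanceAs (Module k (Cohomology k A (Env k A) d))

/-- The action of `Aᵉ` on `𝒟`. -/
def act : Env k A →ₐ[k] Module.End k (Dualizing k A d) := cohomologyAct k A d

instance : Module (Env k A) (Dualizing k A d) := Module.compHom _ (act k A d).toRingHom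

instance : IsScalarTower k (Env k A) (Dualizing k A d) :=
  ⟨fun r u x ↦ by
    change act k A d (r • u) x = r • act k A d u x
    simp⟩

end Dualizing

end Dualizing

/-! ## The fundamental class -/

section Fundamental

variable (k A : Type*) [Field k] [Ring A] [Algebra k A]
variable (N : Type*) [AddCommGroup N] [Module k N] [Module (Env k A) N] [IsScalarTower k (Env k A) N]

/-- The map `N ⊗_A Aᵉ → N`, `n ⊗ (x ⊗ yᵒᵖ) ↦ y · n · x`. -/
def evalTensor : BTensor k A N (Env k A) →ₗ[k] N :=
  BTensor.lift
    (TensorProduct.lift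
      ((Algebra.lsmul k k N : Env k A →ₐ[k] Module.End k N).toLinearMap ∘ₗ Env.flip k A).flip)
    (fun n a u ↦ by
      change Env.flip k A u • rightAct k A N (MulOpposite.op a) n =
        Env.flip k A (leftAct k A (Env k A) a u) • n
      rw [rightAct_apply, leftAct_apply, smul_smul, smul_eq_mul, Env.flip_mul, Env.flip_tmul,
        MulOpposite.unop_one])

theorem evalTensor_proj (n : N) (u : Env k A) :
    evalTensor k A N (BTensor.proj k A N (Env k A) (n ⊗ₜ u)) = Env.flip k A u • n := rfl

/-- `evalTensor` on `C_0(A, N ⊗_A Aᵉ) = (N ⊗_A Aᵉ) ⊗ₖ A^{⊗ 0}`. -/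
def evalChain : Chain k A (BTensor k A N (Env k A)) 0 →ₗ[k] N :=
  evalTensor k A N ∘ₗ (TensorProduct.rid k _).toLinearMap ∘ₗ
    (PiTensorProduct.isEmptyEquiv (Fin 0)).toLinearMap.lTensor _

theorem evalChain_tprod (t : BTensor k A N (Env k A)) (a : Fin 0 → A) :
    evalChain k A N (t ⊗ₜ PiTensorProduct.tprod k a) = evalTensor k A N t := by
  simp [evalChain]

theorem evalChain_boundary :
    evalChain k A N ∘ₗ boundary k A (BTensor k A N (Env k A)) 0 = 0 := by
  refine chain_hom_ext fun t a ↦ ?_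
  obtain ⟨t, rfl⟩ := BTensor.proj_surjective k A N (Env k A) t
  simp only [LinearMap.comp_apply, boundary_tprod, map_add, map_smul, evalChain_tprod,
    Finset.univ_eq_empty, Finset.sum_empty, add_zero, LinearMap.zero_apply]
  induction t using TensorProduct.induction_on with
  | zero => simp
  | add x y hx hy =>
    simp only [map_add, smul_add]
    rw [add_add_add_comm, hx, hy, add_zero]
  | tmul n u =>
    rw [rightAct_proj, leftAct_proj, evalTensor_proj, evalTensor_proj, rightAct_apply,
      leftAct_apply, smul_eq_mul, Env.flip_mul, Env.flip_tmul, smul_smul]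
    simp

/-- The canonical identification `H_0(A, N ⊗_A Aᵉ) ≅ N`, `[n ⊗ (x ⊗ yᵒᵖ)] ↦ y · n · x`. -/
def evalHomology : Homology k A (BTensor k A N (Env k A)) 0 →ₗ[k] N :=
  Submodule.liftQ _ (evalChain k A N ∘ₗ (cycles k A (BTensor k A N (Env k A)) 0).subtype) (by
    rintro ⟨_, _⟩ ⟨w, rfl⟩
    exact LinearMap.congr_fun (evalChain_boundary k A N) w)

variable {k A} in
/-- `c ∈ H_d(A, 𝒟)` is a fundamental class if `c ∩ - : 𝒟 = H^d(A, Aᵉ) → H_0(A, 𝒟 ⊗_A Aᵉ) ≅ 𝒟`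
is the identity. -/
def IsFundamentalClass {d : ℕ} (c : Homology k A (Dualizing k A d) d) : Prop :=
  ∀ α : Cohomology k A (Env k A) d,
    evalHomology k A (Dualizing k A d) (cap (Nat.add_zero d) c α) = (α : Dualizing k A d)

end Fundamental

/-! ## Van den Bergh duality -/

section VanDenBergh

open CategoryTheory

/-- `M` has a finite resolution by finitely generated projective modules. -/
def IsOfTypeFP {R : Type u} [Ring R] (M : ModuleCat.{u} R) : Prop :=
  ∃ P : ProjectiveResolution M, (∀ i, Module.Finite R (P.complex.X i)) ∧
    ∃ n : ℕ, ∀ i, n < i → Limits.IsZero (P.complex.X i)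

/-- A bimodule `D` is invertible if `D ⊗_A E ≅ A ≅ E ⊗_A D` for some bimodule `E`. -/
def IsInvertible (k A : Type u) [Field k] [Ring A] [Algebra k A] (D : Type u) [AddCommGroup D]
    [Module k D] [Module (Env k A) D] [IsScalarTower k (Env k A) D] : Prop :=
  ∃ (E : Type u) (_ : AddCommGroup E) (_ : Module k E) (_ : Module (Env k A) E)
    (_ : IsScalarTower k (Env k A) E),
    Nonempty (BTensor k A D E ≃ₗ[Env k A] Regular k A) ∧
    Nonempty (BTensor k A E D ≃ₗ[Env k A] Regular k A)

/-- `A` is an algebra with Van den Bergh duality, of cohomological dimension `d`. -/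
structure HasVanDenBerghDuality (k A : Type u) [Field k] [Ring A] [Algebra k A] (d : ℕ) :
    Prop where
  typeFP : IsOfTypeFP (ModuleCat.of (Env k A) (Regular k A))
  dimension : projectiveDimension (ModuleCat.of (Env k A) (Regular k A)) = d
  vanishing : ∀ i : ℕ, i ≠ d → Subsingleton (Cohomology k A (Env k A) i)
  invertible : IsInvertible k A (Dualizing k A d)

end VanDenBergh

end Hochschild

end

open Hochschild

open scoped TensorProduct

noncomputable section

namespace Hochschild

/-! ### Functoriality in the coefficients, and right exactness of the tensor product over `A`. -/

section Functoriality

variable {k A : Type*} [Field k] [Ring A] [Algebra k A]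
variable {M M' M'' N : Type*}
  [AddCommGroup M] [Module k M] [Module (Env k A) M] [IsScalarTower k (Env k A) M]
  [AddCommGroup M'] [Module k M'] [Module (Env k A) M'] [IsScalarTower k (Env k A) M']
  [AddCommGroup M''] [Module k M''] [Module (Env k A) M''] [IsScalarTower k (Env k A) M'']
  [AddCommGroup N] [Module k N] [Module (Env k A) N]
  [IsScalarTower k (Env k A) N]

/-! Hochschild cochains with values in `M` are `Aᵉ`-linear maps from the bar resolution to `M`
(`Bar.lift`, `Bar.comp_d`), and Hochschild chains with coefficients in `N` are `N ⊗_{Aᵉ} Bar`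
(`Bar.toChain`, `Bar.boundary_toChain`). The bar resolution is therefore replaced by a homotopy
equivalent projective resolution `X`, finitely generated in each degree (`exists_finiteModel`). As
the projective dimension is at most `d`, the comparison map from `Bar d` to `X d` can be changed by
a homotopy into a map `f'` that kills the image of the differential from degree `d + 1`
(`exists_truncation`), as if `X` ended in degree `d`.

Fundamental class. Let `p i`, `p' i` be a dual basis of `X d`. Each `p' i ∘ f'` is a cocycle with
values in `Aᵉ`, and the canonical element `∑ [p' i ∘ f'] ⊗ g (p i)`, up to the sign of the cap
product, is a cycle: its boundary pairs a dual basis of the module one degree lower with classes of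
coboundaries. Capping it with `[φ]` gives `[φ ∘ g ∘ f'] = [φ]` by the dual basis identity
(`exists_cycle`). The same dual basis expands `g ∘ f'`, which is homotopic to the identity, and so
recovers any cycle up to boundary from its caps with the cocycles `p' i ∘ f'`. This gives uniqueness
(`mem_boundaries_of_evalChain`).

Duality. In degree `p = d` with coefficients `Aᵉ`, capping with the class is the identity of `𝒟`,
once `H_0(A, 𝒟 ⊗_A Aᵉ)` is known to be `𝒟`; a contracting homotopy shows this together with the
vanishing of the higher homology. Free coefficients follow, because cohomology commutes with direct
sums by finite generation of `X p`. A general `M` is treated by induction on `q = d - p`, for all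
bimodules at once, using a presentation `0 → K → F → M → 0` with `F` free. For `q = 0`, right
exactness of `H_0` and `H^{d+1} = 0` suffice (`capSurjective_zero`, `capInjective_zero`). For larger
`q` the connecting maps lead from `M` to `K` one step down, since `F` has no cohomology in degrees
below `d` and `𝒟 ⊗_A F` has no homology in positive degrees (`capInjective_step`,
`capSurjective_step`). The connecting map in homology requires that `𝒟 ⊗_A -` preserve injections,
which is where invertibility of `𝒟` enters (`IsInvertible.map_injective`). -/

@[elab_as_elim]
theorem Env.induction {P : Env k A → Prop} (u : Env k A) (zero : P 0)
    (add : ∀ x y, P x → P y → P (x + y)) (tmul : ∀ (x : A) (y : Aᵐᵒᵖ), P (x ⊗ₜ y)) : P u :=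
  TensorProduct.induction_on u zero tmul add

theorem map_leftAct (φ : M →ₗ[Env k A] M') (a : A) (m : M) :
    φ (leftAct k A M a m) = leftAct k A M' a (φ m) := by
  simp [leftAct_apply]

theorem map_rightAct (φ : M →ₗ[Env k A] M') (a : Aᵐᵒᵖ) (m : M) :
    φ (rightAct k A M a m) = rightAct k A M' a (φ m) := by
  simp [rightAct_apply]

/-- A `k`-linear map commuting with the actions of `A` on both sides is `Aᵉ`-linear. -/
def envLinearMap (f : M →ₗ[k] M')
    (hl : ∀ (a : A) (m : M), f (leftAct k A M a m) = leftAct k A M' a (f m))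
    (hr : ∀ (a : Aᵐᵒᵖ) (m : M), f (rightAct k A M a m) = rightAct k A M' a (f m)) :
    M →ₗ[Env k A] M' where
  toFun := f
  map_add' := f.map_add
  map_smul' u m := by
    induction u using Env.induction with
    | zero =>
      have h₁ : (0 : Env k A) • m = 0 := Module.zero_smul m
      have h₂ : (0 : Env k A) • f m = 0 := Module.zero_smul (f m)
      exact (congrArg f h₁).trans (f.map_zero.trans h₂.symm)
    | add x y hx hy => simp only [add_smul, map_add, hx, hy]
    | tmul x y => simp only [← leftAct_rightAct, hl, hr, RingHom.id_apply]

@[simp] theorem envLinearMap_apply (f : M →ₗ[k] M')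
    (hl : ∀ (a : A) (m : M), f (leftAct k A M a m) = leftAct k A M' a (f m))
    (hr : ∀ (a : Aᵐᵒᵖ) (m : M), f (rightAct k A M a m) = rightAct k A M' a (f m)) (m : M) :
    envLinearMap f hl hr m = f m := rfl

variable (N) in
/-- The map `N ⊗_A M → N ⊗_A M'` induced by an `Aᵉ`-linear map `M → M'`. -/
def BTensor.map (φ : M →ₗ[Env k A] M') : BTensor k A N M →ₗ[Env k A] BTensor k A N M' :=
  envLinearMap
    (BTensor.lift (BTensor.proj k A N M' ∘ₗ (φ.restrictScalars k).lTensor N) fun n a m ↦ by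
      simp only [LinearMap.comp_apply, LinearMap.lTensor_tmul, LinearMap.coe_restrictScalars,
        map_leftAct, BTensor.proj_balanced])
    (fun a t ↦ by
      obtain ⟨t, rfl⟩ := BTensor.proj_surjective k A N M t
      induction t using TensorProduct.induction_on with
      | zero => simp
      | add x y hx hy => simp only [map_add, hx, hy]
      | tmul n m => simp [leftAct_proj])
    (fun a t ↦ by
      obtain ⟨t, rfl⟩ := BTensor.proj_surjective k A N M t
      induction t using TensorProduct.induction_on with
      | zero => simp
      | add x y hx hy => simp only [map_add, hx, hy]
      | tmul n m => simp [rightAct_proj, map_rightAct])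

@[simp] theorem BTensor.map_proj (φ : M →ₗ[Env k A] M') (n : N) (m : M) :
    BTensor.map N φ (BTensor.proj k A N M (n ⊗ₜ m)) = BTensor.proj k A N M' (n ⊗ₜ φ m) := rfl

@[elab_as_elim]
theorem BTensor.induction {P : BTensor k A N M → Prop} (t : BTensor k A N M) (h0 : P 0)
    (hadd : ∀ x y, P x → P y → P (x + y))
    (h : ∀ (n : N) (m : M), P (BTensor.proj k A N M (n ⊗ₜ m))) : P t := by
  obtain ⟨t, rfl⟩ := BTensor.proj_surjective k A N M t
  induction t using TensorProduct.induction_on with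
  | zero => simpa using h0
  | add x y hx hy => rw [map_add]; exact hadd _ _ hx hy
  | tmul n m => exact h n m

theorem BTensor.map_comp (ψ : M' →ₗ[Env k A] M'') (φ : M →ₗ[Env k A] M') :
    BTensor.map N (ψ ∘ₗ φ) = BTensor.map N ψ ∘ₗ BTensor.map N φ := by
  refine LinearMap.ext fun t ↦ ?_
  refine BTensor.induction t (by simp) (fun x y hx hy ↦ ?_) (by simp)
  simp only [map_add, hx, hy]

theorem BTensor.map_surjective {φ : M →ₗ[Env k A] M'} (hφ : Function.Surjective φ) :
    Function.Surjective (BTensor.map N φ) := fun t ↦ by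
  refine BTensor.induction t ⟨0, map_zero _⟩ ?_ fun n m ↦ ?_
  · rintro _ _ ⟨x, rfl⟩ ⟨y, rfl⟩
    exact ⟨x + y, map_add _ _ _⟩
  · obtain ⟨m, rfl⟩ := hφ m
    exact ⟨BTensor.proj k A N M (n ⊗ₜ m), rfl⟩

variable (k A) in
/-- The map of Hochschild chains induced by an `Aᵉ`-linear map. -/
def Chain.map (φ : M →ₗ[Env k A] M') (n : ℕ) : Chain k A M n →ₗ[k] Chain k A M' n :=
  (φ.restrictScalars k).rTensor _

@[simp] theorem Chain.map_tmul (φ : M →ₗ[Env k A] M') (n : ℕ) (m : M) (t : ⨂[k]^n A) :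
    Chain.map k A φ n (m ⊗ₜ t) = φ m ⊗ₜ t := rfl

theorem boundary_map (φ : M →ₗ[Env k A] M') (n : ℕ) (z : Chain k A M (n + 1)) :
    boundary k A M' n (Chain.map k A φ (n + 1) z) = Chain.map k A φ n (boundary k A M n z) := by
  suffices H : boundary k A M' n ∘ₗ Chain.map k A φ (n + 1) =
      Chain.map k A φ n ∘ₗ boundary k A M n from LinearMap.congr_fun H z
  refine chain_hom_ext fun m a ↦ ?_
  simp only [LinearMap.comp_apply, Chain.map_tmul, boundary_tprod, map_add, map_sum, map_smul,
    map_leftAct, map_rightAct]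

theorem Chain.map_mem_cycles (φ : M →ₗ[Env k A] M') {n : ℕ} {z : Chain k A M n}
    (hz : z ∈ cycles k A M n) : Chain.map k A φ n z ∈ cycles k A M' n := by
  cases n with
  | zero => trivial
  | succ n =>
    rw [mem_cycles_succ] at hz ⊢
    rw [boundary_map, hz, map_zero]

theorem Chain.map_mem_boundaries (φ : M →ₗ[Env k A] M') {n : ℕ} {z : Chain k A M n}
    (hz : z ∈ boundaries k A M n) : Chain.map k A φ n z ∈ boundaries k A M' n := by
  obtain ⟨w, rfl⟩ := hz
  exact ⟨Chain.map k A φ _ w, boundary_map φ n w⟩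

theorem Chain.map_surjective {φ : M →ₗ[Env k A] M'} (hφ : Function.Surjective φ) (n : ℕ) :
    Function.Surjective (Chain.map k A φ n) :=
  LinearMap.rTensor_surjective _ hφ

theorem Chain.map_injective {φ : M →ₗ[Env k A] M'} (hφ : Function.Injective φ) (n : ℕ) :
    Function.Injective (Chain.map k A φ n) :=
  Module.Flat.rTensor_preserves_injective_linearMap (φ.restrictScalars k) hφ

theorem Chain.map_exact {φ : M →ₗ[Env k A] M'} {ψ : M' →ₗ[Env k A] M''}
    (h : Function.Exact φ ψ) (hψ : Function.Surjective ψ) (n : ℕ) :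
    Function.Exact (Chain.map k A φ n) (Chain.map k A ψ n) :=
  rTensor_exact (f := φ.restrictScalars k) (g := ψ.restrictScalars k) _ h hψ

theorem capChain_map {p q r : ℕ} (h : p + q = r) (φ : M →ₗ[Env k A] M') (z : Chain k A N r)
    (f : Cochain k A M p) :
    capChain h z (φ.restrictScalars k ∘ₗ f) =
      Chain.map k A (BTensor.map N φ) q (capChain h z f) := by
  suffices H : (capChain h).flip (φ.restrictScalars k ∘ₗ f) =
      Chain.map k A (BTensor.map N φ) q ∘ₗ (capChain h).flip f from LinearMap.congr_fun H z
  refine chain_hom_ext fun n a ↦ ?_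
  simp only [LinearMap.comp_apply, LinearMap.flip_apply, capChain_tprod, map_smul, Chain.map_tmul,
    BTensor.map_proj, LinearMap.coe_restrictScalars]

theorem BTensor.map_exact {φ : M →ₗ[Env k A] M'} {ψ : M' →ₗ[Env k A] M''}
    (h : Function.Exact φ ψ) (hψ : Function.Surjective ψ) :
    Function.Exact (BTensor.map N φ) (BTensor.map N ψ) := by
  have hc : ψ ∘ₗ φ = 0 := LinearMap.ext fun x ↦ h.apply_apply_eq_zero x
  intro t
  constructor
  · intro ht
    obtain ⟨t, rfl⟩ := BTensor.proj_surjective k A N M' t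
    have ht' : (ψ.restrictScalars k).lTensor N t ∈ BTensor.relations k A N M'' :=
      (Submodule.Quotient.mk_eq_zero _).1 ht
    -- Surjectivity of `ψ` lifts every defining relation over `M''` to one over `M'`, so exactness
    -- reduces to that of the tensor product over `k`.
    have hrel : BTensor.relations k A N M'' ≤
        (BTensor.relations k A N M').map ((ψ.restrictScalars k).lTensor N) := by
      refine Submodule.span_le.2 ?_
      rintro _ ⟨n, a, m, rfl⟩
      obtain ⟨m, rfl⟩ := hψ m
      refine ⟨_, Submodule.subset_span ⟨n, a, m, rfl⟩, ?_⟩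
      simp [map_leftAct]
    obtain ⟨s, hs, hst⟩ := hrel ht'
    have hex := lTensor_exact N (f := φ.restrictScalars k) (g := ψ.restrictScalars k) h hψ
    obtain ⟨w, hw⟩ := (hex (t - s)).1 (by rw [map_sub, hst, sub_self])
    refine ⟨BTensor.proj k A N M w, ?_⟩
    change BTensor.proj k A N M' ((φ.restrictScalars k).lTensor N w) = _
    rw [hw, map_sub, sub_eq_self]
    exact (Submodule.Quotient.mk_eq_zero _).2 hs
  · rintro ⟨s, rfl⟩
    rw [← LinearMap.comp_apply, ← BTensor.map_comp, hc]
    refine BTensor.induction s (map_zero _) (fun x y hx hy ↦ ?_) (by simp)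
    rw [map_add, hx, hy, add_zero]

theorem map_mem_cocycles (φ : M →ₗ[Env k A] M') {n : ℕ} {f : Cochain k A M n}
    (hf : f ∈ cocycles k A M n) : φ.restrictScalars k ∘ₗ f ∈ cocycles k A M' n := by
  have hf' : coboundary k A M n f = 0 := hf
  change coboundary k A M' n _ = 0
  rw [coboundary_comp, hf', LinearMap.comp_zero]

theorem map_mem_coboundaries (φ : M →ₗ[Env k A] M') {n : ℕ} {f : Cochain k A M n}
    (hf : f ∈ coboundaries k A M n) : φ.restrictScalars k ∘ₗ f ∈ coboundaries k A M' n := by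
  cases n with
  | zero =>
    obtain rfl : f = 0 := hf
    exact LinearMap.comp_zero _
  | succ n =>
    obtain ⟨g, rfl⟩ := hf
    exact ⟨φ.restrictScalars k ∘ₗ g, coboundary_comp φ n g⟩

end Functoriality

/-! ### Associativity and unit of the tensor product; invertible bimodules are flat. -/

section Associator

variable {k A : Type*} [Field k] [Ring A] [Algebra k A]
variable {P Q X Y : Type*}
  [AddCommGroup P] [Module k P] [Module (Env k A) P] [IsScalarTower k (Env k A) P]
  [AddCommGroup Q] [Module k Q] [Module (Env k A) Q] [IsScalarTower k (Env k A) Q]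
  [AddCommGroup X] [Module k X] [Module (Env k A) X] [IsScalarTower k (Env k A) X]
  [AddCommGroup Y] [Module k Y] [Module (Env k A) Y] [IsScalarTower k (Env k A) Y]

variable (k A P Q X) in
/-- `(p ⊗ q) ⊗ x ↦ p ⊗ (q ⊗ x)`. -/
def BTensor.assocHom :
    BTensor k A (BTensor k A P Q) X →ₗ[k] BTensor k A P (BTensor k A Q X) :=
  BTensor.lift
    (TensorProduct.lift (BTensor.lift
      (TensorProduct.curry (BTensor.proj k A P (BTensor k A Q X) ∘ₗ
        (BTensor.proj k A Q X).lTensor P ∘ₗ (TensorProduct.assoc k P Q X).toLinearMap))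
      fun p a q ↦ LinearMap.ext fun x ↦ by
        simp [BTensor.proj_balanced, leftAct_proj]))
    fun t a x ↦ by
      refine BTensor.induction t (by simp) (fun t₁ t₂ h₁ h₂ ↦ ?_) fun p q ↦ ?_
      · simp only [map_add, TensorProduct.add_tmul, h₁, h₂]
      · simp [rightAct_proj, BTensor.proj_balanced]

variable (k A P Q X) in
/-- `p ⊗ (q ⊗ x) ↦ (p ⊗ q) ⊗ x`. -/
def BTensor.assocInv :
    BTensor k A P (BTensor k A Q X) →ₗ[k] BTensor k A (BTensor k A P Q) X :=
  BTensor.lift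
    (TensorProduct.lift (BTensor.lift
      (TensorProduct.curry (BTensor.proj k A (BTensor k A P Q) X ∘ₗ
        (BTensor.proj k A P Q).rTensor X ∘ₗ (TensorProduct.assoc k P Q X).symm.toLinearMap)).flip
      fun q a x ↦ LinearMap.ext fun p ↦ by
        simp [← BTensor.proj_balanced, rightAct_proj]).flip)
    fun p a t ↦ by
      refine BTensor.induction t (by simp) (fun t₁ t₂ h₁ h₂ ↦ ?_) fun q x ↦ ?_
      · simp only [map_add, TensorProduct.tmul_add, h₁, h₂]
      · simp [leftAct_proj, BTensor.proj_balanced]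

@[simp] theorem BTensor.assocHom_proj (p : P) (q : Q) (x : X) :
    BTensor.assocHom k A P Q X
      (BTensor.proj k A _ X (BTensor.proj k A P Q (p ⊗ₜ q) ⊗ₜ x)) =
      BTensor.proj k A P _ (p ⊗ₜ BTensor.proj k A Q X (q ⊗ₜ x)) := rfl

@[simp] theorem BTensor.assocInv_proj (p : P) (q : Q) (x : X) :
    BTensor.assocInv k A P Q X (BTensor.proj k A P _ (p ⊗ₜ BTensor.proj k A Q X (q ⊗ₜ x))) =
      BTensor.proj k A _ X (BTensor.proj k A P Q (p ⊗ₜ q) ⊗ₜ x) := rfl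

theorem BTensor.assocInv_assocHom (t : BTensor k A (BTensor k A P Q) X) :
    BTensor.assocInv k A P Q X (BTensor.assocHom k A P Q X t) = t := by
  refine BTensor.induction t (by simp) (fun _ _ h₁ h₂ ↦ by rw [map_add, map_add, h₁, h₂])
    fun s x ↦ ?_
  refine BTensor.induction s (by simp)
    (fun _ _ h₁ h₂ ↦ by simp only [TensorProduct.add_tmul, map_add, h₁, h₂])
    fun p q ↦ rfl

theorem BTensor.assocHom_assocInv (t : BTensor k A P (BTensor k A Q X)) :
    BTensor.assocHom k A P Q X (BTensor.assocInv k A P Q X t) = t := by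
  refine BTensor.induction t (by simp) (fun _ _ h₁ h₂ ↦ by rw [map_add, map_add, h₁, h₂])
    fun p s ↦ ?_
  refine BTensor.induction s (by simp)
    (fun _ _ h₁ h₂ ↦ by simp only [TensorProduct.tmul_add, map_add, h₁, h₂])
    fun p q ↦ rfl

variable (k A) in
/-- The identification of the regular bimodule with `A`. -/
def Regular.equiv : Regular k A ≃ₗ[k] A := LinearEquiv.refl k A

theorem Regular.equiv_smul (x : A) (y : Aᵐᵒᵖ) (a : Regular k A) :
    Regular.equiv k A ((x ⊗ₜ[k] y : Env k A) • a) = x * Regular.equiv k A a * y.unop :=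
  Regular.smul_def k A x y a

instance : IsScalarTower k (Env k A) (Regular k A) :=
  ⟨fun r u a ↦ by
    apply (Regular.equiv k A).injective
    induction u using Env.induction with
    | zero =>
      have h : (0 : Env k A) • a = 0 := Module.zero_smul a
      have h' : r • (0 : Env k A) = 0 := smul_zero r
      rw [h', h, smul_zero]
    | add x y hx hy => simp only [smul_add, add_smul, map_add, hx, hy]
    | tmul x y =>
      rw [TensorProduct.smul_tmul', (Regular.equiv k A).map_smul r, Regular.equiv_smul,
        Regular.equiv_smul, smul_mul_assoc, smul_mul_assoc]⟩

theorem Regular.equiv_leftAct (a : A) (b : Regular k A) :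
    Regular.equiv k A (leftAct k A (Regular k A) a b) = a * Regular.equiv k A b := by
  rw [leftAct_apply, Regular.equiv_smul, MulOpposite.unop_one, mul_one]

theorem Regular.equiv_rightAct (a : A) (b : Regular k A) :
    Regular.equiv k A (rightAct k A (Regular k A) (MulOpposite.op a) b) =
      Regular.equiv k A b * a := by
  rw [rightAct_apply, Regular.equiv_smul, MulOpposite.unop_op, one_mul]

/-- `t ⊗ x ↦ u(t) · x`, for a bimodule map `u` to `A`. -/
def BTensor.evalLeft (u : P →ₗ[Env k A] Regular k A) : BTensor k A P X →ₗ[k] X :=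
  BTensor.lift (TensorProduct.lift ((leftAct k A X).toLinearMap ∘ₗ
    (Regular.equiv k A).toLinearMap ∘ₗ u.restrictScalars k)) fun t a x ↦ by
      simp [map_rightAct, Regular.equiv_rightAct]

theorem BTensor.evalLeft_proj (u : P →ₗ[Env k A] Regular k A) (t : P) (x : X) :
    BTensor.evalLeft u (BTensor.proj k A P X (t ⊗ₜ x)) =
      leftAct k A X (Regular.equiv k A (u t)) x := rfl

theorem BTensor.evalLeft_map (u : P →ₗ[Env k A] Regular k A) (φ : X →ₗ[Env k A] Y)
    (t : BTensor k A P X) :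
    BTensor.evalLeft u (BTensor.map P φ t) = φ (BTensor.evalLeft u t) := by
  refine BTensor.induction t (by simp)
    (fun _ _ h₁ h₂ ↦ by simp only [map_add, h₁, h₂]) fun p x ↦ ?_
  rw [BTensor.map_proj, BTensor.evalLeft_proj, BTensor.evalLeft_proj, map_leftAct]

/-- The unit isomorphism `A ⊗_A X ≅ X`, for a bimodule `P` isomorphic to `A`: the scalar `u p` moves
across the tensor sign and turns `u⁻¹ 1` back into `p`. With `evalLeft_symm_one` this gives both
composites. -/
theorem BTensor.proj_symm_one_evalLeft (u : P ≃ₗ[Env k A] Regular k A) (t : BTensor k A P X) :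
    BTensor.proj k A P X (u.symm ((Regular.equiv k A).symm 1) ⊗ₜ
      BTensor.evalLeft u.toLinearMap t) = t := by
  refine BTensor.induction t (by simp)
    (fun _ _ h₁ h₂ ↦ by rw [map_add, TensorProduct.tmul_add, map_add, h₁, h₂])
    fun p x ↦ ?_
  rw [BTensor.evalLeft_proj, ← BTensor.proj_balanced]
  congr 2
  apply u.injective
  refine (map_rightAct u.toLinearMap _ _).trans ?_
  apply (Regular.equiv k A).injective
  rw [Regular.equiv_rightAct]
  simp

theorem BTensor.evalLeft_symm_one (u : P ≃ₗ[Env k A] Regular k A) (x : X) :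
    BTensor.evalLeft u.toLinearMap
      (BTensor.proj k A P X (u.symm ((Regular.equiv k A).symm 1) ⊗ₜ x)) = x := by
  rw [BTensor.evalLeft_proj]
  simp

theorem BTensor.assocInv_map (φ : X →ₗ[Env k A] Y) (t : BTensor k A P (BTensor k A Q X)) :
    BTensor.assocInv k A P Q Y (BTensor.map P (BTensor.map Q φ) t) =
      BTensor.map _ φ (BTensor.assocInv k A P Q X t) := by
  refine BTensor.induction t (by simp)
    (fun _ _ h₁ h₂ ↦ by simp only [map_add, h₁, h₂]) fun p s ↦ ?_
  refine BTensor.induction s (by simp)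
    (fun _ _ h₁ h₂ ↦ by simp only [TensorProduct.tmul_add, map_add, h₁, h₂])
    fun p q ↦ rfl

/-- Tensoring with a bimodule `P` that has a two-sided inverse `Q` preserves injectivity. -/
theorem BTensor.map_injective_of_inverse (u : BTensor k A P Q ≃ₗ[Env k A] Regular k A)
    (v : BTensor k A Q P ≃ₗ[Env k A] Regular k A) {φ : X →ₗ[Env k A] Y}
    (hφ : Function.Injective φ) : Function.Injective (BTensor.map P φ) := by
  refine (injective_iff_map_eq_zero _).2 fun x hx ↦ ?_
  -- Under `Q ⊗ (P ⊗ X) ≅ (Q ⊗ P) ⊗ X ≅ X` the functor `Q ⊗ P ⊗ -` becomes the identity, so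
  -- injectivity of `φ` applies to the image of `q ⊗ x`. Tensoring once more with `P` and using `P ⊗
  -- Q ≅ A` then yields `x = 0`. The two isomorphisms `u` and `v` need not be compatible.
  have key (q : Q) : BTensor.proj k A Q _ (q ⊗ₜ x) = 0 := by
    have h₁ : BTensor.evalLeft v.toLinearMap (BTensor.assocInv k A Q P X
        (BTensor.proj k A Q _ (q ⊗ₜ x))) = 0 := by
      apply hφ
      rw [← BTensor.evalLeft_map, ← BTensor.assocInv_map, BTensor.map_proj, hx]
      simp
    have h₂ := BTensor.proj_symm_one_evalLeft v (BTensor.assocInv k A Q P X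
        (BTensor.proj k A Q _ (q ⊗ₜ x)))
    rw [h₁, TensorProduct.tmul_zero, map_zero] at h₂
    rw [← BTensor.assocHom_assocInv (BTensor.proj k A Q _ (q ⊗ₜ x)), ← h₂, map_zero]
  have key' (t : BTensor k A P Q) :
      BTensor.assocHom k A P Q _ (BTensor.proj k A _ _ (t ⊗ₜ x)) = 0 := by
    refine BTensor.induction t (by simp)
      (fun _ _ h₁ h₂ ↦ by simp only [TensorProduct.add_tmul, map_add, h₁, h₂, add_zero])
      fun p q ↦ ?_
    rw [BTensor.assocHom_proj, key, TensorProduct.tmul_zero, map_zero]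
  have h₃ := BTensor.assocInv_assocHom (BTensor.proj k A _ _
    (u.symm ((Regular.equiv k A).symm 1) ⊗ₜ x))
  rw [key', map_zero] at h₃
  rw [← BTensor.evalLeft_symm_one u x, ← h₃, map_zero]

end Associator

theorem IsInvertible.map_injective {k A : Type u} [Field k] [Ring A] [Algebra k A] {D : Type u}
    [AddCommGroup D] [Module k D] [Module (Env k A) D] [IsScalarTower k (Env k A) D]
    (hD : IsInvertible k A D) {X Y : Type*}
    [AddCommGroup X] [Module k X] [Module (Env k A) X] [IsScalarTower k (Env k A) X]
    [AddCommGroup Y] [Module k Y] [Module (Env k A) Y] [IsScalarTower k (Env k A) Y]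
    {φ : X →ₗ[Env k A] Y} (hφ : Function.Injective φ) : Function.Injective (BTensor.map D φ) := by
  obtain ⟨E, _, _, _, _, ⟨u⟩, ⟨v⟩⟩ := hD
  exact BTensor.map_injective_of_inverse u v hφ

/-! ### Contracting homotopies from a splitting of right multiplication. -/

section Contraction

variable (k A : Type*) [Field k] [Ring A] [Algebra k A]

/-- `a₀ ⊗ (a₁ ⊗ ⋯ ⊗ aₙ) ↦ a₀ ⊗ ⋯ ⊗ aₙ`. -/
def consTensor (n : ℕ) : A ⊗[k] (⨂[k]^n A) →ₗ[k] ⨂[k]^(n + 1) A :=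
  TensorProduct.lift ((PiTensorProduct.lift (R := k)).toLinearMap ∘ₗ
    (PiTensorProduct.tprod k : MultilinearMap k (fun _ : Fin (n + 1) ↦ A) _).curryLeft)

@[simp] theorem consTensor_tmul_tprod (n : ℕ) (y : A) (a : Fin n → A) :
    consTensor k A n (y ⊗ₜ PiTensorProduct.tprod k a) =
      PiTensorProduct.tprod k (Fin.cons y a : Fin (n + 1) → A) := by
  simp [consTensor]

variable {k A}

variable (M : Type*) [AddCommGroup M] [Module k M]

/-- `(m ⊗ a₀) ⊗ (a₁ ⊗ ⋯ ⊗ aₙ) ↦ m ⊗ (a₀ ⊗ ⋯ ⊗ aₙ)`. -/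
def Chain.cons (n : ℕ) : (M ⊗[k] A) ⊗[k] (⨂[k]^n A) →ₗ[k] Chain k A M (n + 1) :=
  (consTensor k A n).lTensor M ∘ₗ (TensorProduct.assoc k M A (⨂[k]^n A)).toLinearMap

@[simp] theorem Chain.cons_tmul (n : ℕ) (m : M) (y : A) (a : Fin n → A) :
    Chain.cons M n ((m ⊗ₜ y) ⊗ₜ PiTensorProduct.tprod k a) =
      m ⊗ₜ PiTensorProduct.tprod k (Fin.cons y a : Fin (n + 1) → A) := by
  simp [Chain.cons]

theorem contractNth_zero_cons {n : ℕ} (y : A) (a : Fin (n + 1) → A) :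
    Fin.contractNth (0 : Fin (n + 1)).castSucc (· * ·) (Fin.cons y a : Fin (n + 2) → A) =
      (Fin.cons (y * a 0) (Fin.tail a) : Fin (n + 1) → A) := by
  funext i
  refine Fin.cases ?_ (fun i ↦ ?_) i
  · rw [Fin.contractNth_apply_of_eq _ _ _ _ (by simp)]
    rfl
  · rw [Fin.contractNth_apply_of_gt _ _ _ _ (by simp)]
    simp [Fin.tail]

theorem contractNth_succ_cons {n : ℕ} (y : A) (a : Fin (n + 1) → A) (j : Fin n) :
    Fin.contractNth j.succ.castSucc (· * ·) (Fin.cons y a : Fin (n + 2) → A) =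
      (Fin.cons y (Fin.contractNth j.castSucc (· * ·) a) : Fin (n + 1) → A) := by
  funext i
  refine Fin.cases ?_ (fun i ↦ ?_) i
  · rw [Fin.contractNth_apply_of_lt _ _ _ _ (by simp)]
    simp
  · change _ = Fin.contractNth j.castSucc (· * ·) a i
    rcases lt_trichotomy (i : ℕ) j with h | h | h
    · rw [Fin.contractNth_apply_of_lt _ _ _ _ (by simpa using h),
        Fin.contractNth_apply_of_lt _ _ _ _ (by simpa using h)]
      rfl
    · rw [Fin.contractNth_apply_of_eq _ _ _ _ (by simpa using h),
        Fin.contractNth_apply_of_eq _ _ _ _ (by simpa using h)]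
      rfl
    · rw [Fin.contractNth_apply_of_gt _ _ _ _ (by simpa using h),
        Fin.contractNth_apply_of_gt _ _ _ _ (by simpa using h)]
      rfl

theorem init_cons {α : Type*} {n : ℕ} (y : α) (a : Fin (n + 1) → α) :
    Fin.init (Fin.cons y a : Fin (n + 2) → α) = (Fin.cons y (Fin.init a) : Fin (n + 1) → α) := by
  funext i
  refine Fin.cases ?_ (fun i ↦ ?_) i <;> rfl

variable {M}
variable (s : M →ₗ[k] M ⊗[k] A)

/-- The map of chains `m ⊗ t ↦ m' ⊗ (a ⊗ t)`, where `s m = m' ⊗ a`. -/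
def contraction (n : ℕ) : Chain k A M n →ₗ[k] Chain k A M (n + 1) :=
  Chain.cons M n ∘ₗ s.rTensor _

@[simp] theorem contraction_tmul (n : ℕ) (m : M) (t : ⨂[k]^n A) :
    contraction s n (m ⊗ₜ t) = Chain.cons M n (s m ⊗ₜ t) := rfl

variable (M) [Module (Env k A) M] [IsScalarTower k (Env k A) M]

/-- The first face multiplies the two factors of `w`. The remaining faces, shifted by one sign, are
those of the Hochschild boundary with coefficients in the bimodule `M ⊗ₖ A`, where the left action
is on `M` and the right action on `A`. -/
theorem boundary_cons_succ (n : ℕ) (w : M ⊗[k] A) (a : Fin (n + 1) → A) :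
    boundary k A M (n + 1) (Chain.cons M (n + 1) (w ⊗ₜ PiTensorProduct.tprod k a)) =
      rightMul k A M w ⊗ₜ PiTensorProduct.tprod k a
      - (Chain.cons M n ((LinearMap.mulRight k (a 0)).lTensor M w ⊗ₜ
            PiTensorProduct.tprod k (Fin.tail a))
        + ∑ j : Fin n, (-1 : k) ^ ((j : ℕ) + 1) • Chain.cons M n
            (w ⊗ₜ PiTensorProduct.tprod k (Fin.contractNth j.castSucc (· * ·) a))
        + (-1 : k) ^ (n + 1) • Chain.cons M n
            ((leftAct k A M (a (Fin.last n))).rTensor A w ⊗ₜ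
              PiTensorProduct.tprod k (Fin.init a))) := by
  induction w using TensorProduct.induction_on with
  | zero => simp
  | add x y hx hy =>
    simp only [TensorProduct.add_tmul, map_add, hx, hy, smul_add, Finset.sum_add_distrib]
    abel
  | tmul m y =>
    simp only [Chain.cons_tmul, boundary_tprod, Fin.sum_univ_succ, contractNth_zero_cons,
      contractNth_succ_cons, LinearMap.lTensor_tmul, LinearMap.rTensor_tmul, rightMul_tmul,
      LinearMap.mulRight_apply, Fin.cons_zero, Fin.tail_cons, init_cons, ← Fin.succ_last,
      Fin.cons_succ, Fin.val_succ, pow_succ (-1 : k) (_ + 1), mul_neg, mul_one, neg_smul,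
      Finset.sum_neg_distrib, Fin.val_zero, zero_add, pow_one, one_smul]
    abel

/-- In the lowest degree the last face consumes the inserted entry itself, which leaves the term
that obstructs contractibility. -/
theorem boundary_cons_zero (w : M ⊗[k] A) (a : Fin 0 → A) :
    boundary k A M 0 (Chain.cons M 0 (w ⊗ₜ PiTensorProduct.tprod k a)) =
      rightMul k A M w ⊗ₜ PiTensorProduct.tprod k a
      - leftMul k A M (TensorProduct.comm k M A w) ⊗ₜ PiTensorProduct.tprod k a := by
  induction w using TensorProduct.induction_on with
  | zero => simp
  | add x y hx hy =>
    simp only [TensorProduct.add_tmul, map_add, hx, hy]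
    abel
  | tmul m y =>
    have h : Fin.init (Fin.cons y a : Fin 1 → A) = a := Subsingleton.elim _ _
    have h' : Fin.tail (Fin.cons y a : Fin 1 → A) = a := Subsingleton.elim _ _
    simp [boundary_tprod, h, h', sub_eq_add_neg]

variable {M}
/-- A bimodule splitting `s` of the multiplication `M ⊗ₖ A → M` contracts the Hochschild chain
complex. -/
theorem boundary_contraction_succ
    (hs : ∀ m, rightMul k A M (s m) = m)
    (hl : ∀ a m, s (leftAct k A M a m) = (leftAct k A M a).rTensor A (s m))
    (hr : ∀ a m, s (rightAct k A M (MulOpposite.op a) m) =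
      (LinearMap.mulRight k a).lTensor M (s m)) (n : ℕ) (z : Chain k A M (n + 1)) :
    boundary k A M (n + 1) (contraction s (n + 1) z) =
      z - contraction s n (boundary k A M n z) := by
  suffices H : boundary k A M (n + 1) ∘ₗ contraction s (n + 1) =
      LinearMap.id - contraction s n ∘ₗ boundary k A M n from LinearMap.congr_fun H z
  refine chain_hom_ext fun m a ↦ ?_
  simp only [LinearMap.comp_apply, contraction_tmul, boundary_cons_succ, hs, LinearMap.sub_apply,
    LinearMap.id_apply, boundary_tprod, map_add, map_sum, map_smul, hl, hr]

theorem boundary_contraction_zero (hs : ∀ m, rightMul k A M (s m) = m) (m : M) (a : Fin 0 → A) :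
    boundary k A M 0 (contraction s 0 (m ⊗ₜ PiTensorProduct.tprod k a)) =
      m ⊗ₜ PiTensorProduct.tprod k a
      - leftMul k A M (TensorProduct.comm k M A (s m)) ⊗ₜ PiTensorProduct.tprod k a := by
  rw [contraction_tmul, boundary_cons_zero, hs]

end Contraction

/-! ### Homology with coefficients in `N ⊗_A Aᵉ`. -/

section ContractionBTensor

variable (k A : Type*) [Field k] [Ring A] [Algebra k A]
variable (N : Type*) [AddCommGroup N] [Module k N] [Module (Env k A) N]
  [IsScalarTower k (Env k A) N]

/-- `x ⊗ y ↦ (x ⊗ 1) ⊗ y`. -/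
def Env.splitting : Env k A →ₗ[k] Env k A ⊗[k] A :=
  TensorProduct.map (Algebra.TensorProduct.includeLeft : A →ₐ[k] Env k A).toLinearMap
    (MulOpposite.opLinearEquiv k).symm.toLinearMap

theorem Env.splitting_tmul (x : A) (y : Aᵐᵒᵖ) :
    Env.splitting k A (x ⊗ₜ y) = (x ⊗ₜ 1) ⊗ₜ y.unop := rfl

theorem Env.rightMul_splitting (u : Env k A) :
    rightMul k A (Env k A) (Env.splitting k A u) = u := by
  induction u using Env.induction with
  | zero => exact (congrArg _ (map_zero (Env.splitting k A))).trans (map_zero _)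
  | add x y hx hy => rw [map_add, map_add, hx, hy]
  | tmul x y =>
    rw [Env.splitting_tmul, rightMul_tmul, rightAct_apply, smul_eq_mul,
      Algebra.TensorProduct.tmul_mul_tmul]
    simp

theorem Env.splitting_leftAct (a : A) (u : Env k A) :
    Env.splitting k A (leftAct k A (Env k A) a u) =
      (leftAct k A (Env k A) a).rTensor A (Env.splitting k A u) := by
  suffices H : Env.splitting k A ∘ₗ leftAct k A (Env k A) a =
      (leftAct k A (Env k A) a).rTensor A ∘ₗ Env.splitting k A from LinearMap.congr_fun H u
  refine TensorProduct.ext' fun x y ↦ ?_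
  simp only [LinearMap.comp_apply, leftAct_apply, smul_eq_mul,
    Algebra.TensorProduct.tmul_mul_tmul, Env.splitting_tmul, LinearMap.rTensor_tmul, one_mul]

theorem Env.splitting_rightAct (a : A) (u : Env k A) :
    Env.splitting k A (rightAct k A (Env k A) (MulOpposite.op a) u) =
      (LinearMap.mulRight k a).lTensor (Env k A) (Env.splitting k A u) := by
  suffices H : Env.splitting k A ∘ₗ rightAct k A (Env k A) (MulOpposite.op a) =
      (LinearMap.mulRight k a).lTensor (Env k A) ∘ₗ Env.splitting k A from LinearMap.congr_fun H u
  refine TensorProduct.ext' fun x y ↦ ?_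
  simp only [LinearMap.comp_apply, rightAct_apply, smul_eq_mul,
    Algebra.TensorProduct.tmul_mul_tmul, Env.splitting_tmul, LinearMap.lTensor_tmul, one_mul,
    MulOpposite.unop_mul, MulOpposite.unop_op, LinearMap.mulRight_apply]

/-- `n ⊗ (x ⊗ y) ↦ (n ⊗ (x ⊗ 1)) ⊗ y`. -/
def BTensor.splitting : BTensor k A N (Env k A) →ₗ[k] BTensor k A N (Env k A) ⊗[k] A :=
  BTensor.lift ((BTensor.proj k A N (Env k A)).rTensor A ∘ₗ
    (TensorProduct.assoc k N (Env k A) A).symm.toLinearMap ∘ₗ (Env.splitting k A).lTensor N)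
    fun n a u ↦ by
      simp only [LinearMap.comp_apply, LinearMap.lTensor_tmul, Env.splitting_leftAct]
      induction Env.splitting k A u using TensorProduct.induction_on with
      | zero => simp
      | add x y hx hy => simp only [map_add, TensorProduct.tmul_add, hx, hy]
      | tmul v y => simp [BTensor.proj_balanced]

variable {k A N}

theorem BTensor.splitting_proj (n : N) (x : A) (y : Aᵐᵒᵖ) :
    BTensor.splitting k A N (BTensor.proj k A N (Env k A) (n ⊗ₜ (x ⊗ₜ y))) =
      BTensor.proj k A N (Env k A) (n ⊗ₜ (x ⊗ₜ 1)) ⊗ₜ y.unop := rfl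

@[elab_as_elim]
theorem BTensor.induction_env {P : BTensor k A N (Env k A) → Prop}
    (t : BTensor k A N (Env k A)) (h0 : P 0) (hadd : ∀ x y, P x → P y → P (x + y))
    (h : ∀ (n : N) (x : A) (y : Aᵐᵒᵖ), P (BTensor.proj k A N (Env k A) (n ⊗ₜ (x ⊗ₜ y)))) :
    P t := by
  refine BTensor.induction t h0 hadd fun n u ↦ ?_
  induction u using Env.induction with
  | zero =>
    have : n ⊗ₜ[k] (0 : Env k A) = 0 := TensorProduct.tmul_zero _ _
    rw [this, map_zero]
    exact h0
  | add x y hx hy =>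
    rw [TensorProduct.tmul_add, map_add]
    exact hadd _ _ hx hy
  | tmul x y => exact h n x y

theorem BTensor.rightMul_splitting (t : BTensor k A N (Env k A)) :
    rightMul k A _ (BTensor.splitting k A N t) = t := by
  refine BTensor.induction_env t (by simp) (fun _ _ h₁ h₂ ↦ by simp only [map_add, h₁, h₂])
    fun n x y ↦ ?_
  rw [BTensor.splitting_proj, rightMul_tmul, rightAct_proj, rightAct_apply, smul_eq_mul,
    Algebra.TensorProduct.tmul_mul_tmul]
  simp

theorem BTensor.splitting_leftAct (a : A) (t : BTensor k A N (Env k A)) :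
    BTensor.splitting k A N (leftAct k A _ a t) =
      (leftAct k A _ a).rTensor A (BTensor.splitting k A N t) := by
  refine BTensor.induction_env t (by simp) (fun _ _ h₁ h₂ ↦ by simp only [map_add, h₁, h₂])
    fun n x y ↦ ?_
  rw [leftAct_proj, BTensor.splitting_proj, BTensor.splitting_proj, LinearMap.rTensor_tmul,
    leftAct_proj]

theorem BTensor.splitting_rightAct (a : A) (t : BTensor k A N (Env k A)) :
    BTensor.splitting k A N (rightAct k A _ (MulOpposite.op a) t) =
      (LinearMap.mulRight k a).lTensor _ (BTensor.splitting k A N t) := by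
  refine BTensor.induction_env t (by simp) (fun _ _ h₁ h₂ ↦ by simp only [map_add, h₁, h₂])
    fun n x y ↦ ?_
  rw [rightAct_proj, rightAct_apply, smul_eq_mul, Algebra.TensorProduct.tmul_mul_tmul,
    BTensor.splitting_proj, BTensor.splitting_proj, LinearMap.lTensor_tmul]
  simp

/-- `H_n(A, N ⊗_A Aᵉ) = 0` for `n > 0`. -/
theorem BTensor.mem_boundaries_succ {n : ℕ} {z : Chain k A (BTensor k A N (Env k A)) (n + 1)}
    (hz : z ∈ cycles k A _ (n + 1)) : z ∈ boundaries k A _ (n + 1) := by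
  rw [mem_cycles_succ] at hz
  refine ⟨contraction (BTensor.splitting k A N) (n + 1) z, ?_⟩
  rw [boundary_contraction_succ _ BTensor.rightMul_splitting BTensor.splitting_leftAct
    BTensor.splitting_rightAct, hz, map_zero, sub_zero]

theorem chain_zero_eq {M : Type*} [AddCommGroup M] [Module k M] [Module (Env k A) M]
    [IsScalarTower k (Env k A) M] (z : Chain k A M 0) :
    ∃ m : M, z = m ⊗ₜ PiTensorProduct.tprod k (Fin.elim0 : Fin 0 → A) := by
  induction z using TensorProduct.induction_on with
  | zero => exact ⟨0, by simp⟩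
  | add x y hx hy =>
    obtain ⟨m, rfl⟩ := hx
    obtain ⟨m', rfl⟩ := hy
    exact ⟨m + m', (TensorProduct.add_tmul _ _ _).symm⟩
  | tmul m t =>
    obtain ⟨c, rfl⟩ :=
      (PiTensorProduct.isEmptyEquiv (R := k) (s := fun _ ↦ A) (Fin 0)).symm.surjective t
    refine ⟨c • m, ?_⟩
    rw [PiTensorProduct.isEmptyEquiv_symm_apply, TensorProduct.tmul_smul, TensorProduct.smul_tmul']
    congr 2

/-- The defect of the homotopy in degree `0` depends only on the image of `t` in `N`; hence `H_0(A,
N ⊗_A Aᵉ) → N` is injective. -/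
theorem BTensor.leftMul_splitting (t : BTensor k A N (Env k A)) :
    leftMul k A _ (TensorProduct.comm k _ A (BTensor.splitting k A N t)) =
      BTensor.proj k A N (Env k A) (evalTensor k A N t ⊗ₜ 1) := by
  refine BTensor.induction_env t (by simp)
    (fun _ _ h₁ h₂ ↦ by simp only [map_add, TensorProduct.add_tmul, h₁, h₂]) fun n x y ↦ ?_
  rw [BTensor.splitting_proj, TensorProduct.comm_tmul, leftMul_tmul, leftAct_proj,
    evalTensor_proj, Env.flip_tmul, ← rightAct_leftAct, BTensor.proj_balanced,
    leftAct_apply (M := Env k A), smul_eq_mul, mul_one]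

/-- The kernel of `C_0(A, N ⊗_A Aᵉ) → N` consists of boundaries. -/
theorem mem_boundaries_of_evalChain_eq_zero {z : Chain k A (BTensor k A N (Env k A)) 0}
    (hz : evalChain k A N z = 0) : z ∈ boundaries k A _ 0 := by
  obtain ⟨t, rfl⟩ := chain_zero_eq z
  rw [evalChain_tprod] at hz
  refine ⟨contraction (BTensor.splitting k A N) 0
    (t ⊗ₜ PiTensorProduct.tprod k (Fin.elim0 : Fin 0 → A)), ?_⟩
  rw [boundary_contraction_zero _ BTensor.rightMul_splitting, BTensor.leftMul_splitting, hz]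
  simp

end ContractionBTensor

/-! ### The bar resolution, and Hochschild complexes as Hom and tensor product with it. -/

section BarComplex

variable (k A : Type*) [Field k] [Ring A] [Algebra k A]

theorem Env.flip_flip (u : Env k A) : Env.flip k A (Env.flip k A u) = u := by
  suffices H : Env.flip k A ∘ₗ Env.flip k A = LinearMap.id from LinearMap.congr_fun H u
  exact TensorProduct.ext' fun x y ↦ by simp

/-- The bar resolution `Aᵉ ⊗ₖ A^{⊗ n}` of `A`. -/
def Bar (n : ℕ) : Type _ := Env k A ⊗[k] (⨂[k]^n A)

instance (n : ℕ) : AddCommGroup (Bar k A n) :=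
  inferInstanceAs (AddCommGroup (Env k A ⊗[k] (⨂[k]^n A)))
instance (n : ℕ) : Module k (Bar k A n) :=
  inferInstanceAs (Module k (Env k A ⊗[k] (⨂[k]^n A)))
instance (n : ℕ) : Module (Env k A) (Bar k A n) :=
  inferInstanceAs (Module (Env k A) (Env k A ⊗[k] (⨂[k]^n A)))
instance (n : ℕ) : IsScalarTower k (Env k A) (Bar k A n) :=
  inferInstanceAs (IsScalarTower k (Env k A) (Env k A ⊗[k] (⨂[k]^n A)))
instance (n : ℕ) : Module.Projective (Env k A) (Bar k A n) :=
  inferInstanceAs (Module.Projective (Env k A) (Env k A ⊗[k] (⨂[k]^n A)))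

namespace Bar

/-- The identification of the bar resolution with `Aᵉ ⊗ₖ A^{⊗ n}`. -/
def equiv (n : ℕ) : Bar k A n ≃ₗ[k] Env k A ⊗[k] (⨂[k]^n A) := LinearEquiv.refl _ _

/-- The pure tensor `u ⊗ t`, as an element of the bar resolution. -/
def mk {n : ℕ} (u : Env k A) (t : ⨂[k]^n A) : Bar k A n := (equiv k A n).symm (u ⊗ₜ t)

variable {k A} in
@[simp] theorem equiv_mk {n : ℕ} (u : Env k A) (t : ⨂[k]^n A) :
    equiv k A n (mk k A u t) = u ⊗ₜ t := rfl

variable {k A} in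
theorem smul_mk {n : ℕ} (u v : Env k A) (t : ⨂[k]^n A) :
    u • mk k A v t = mk k A (u * v) t := rfl

variable {k A} in
@[elab_as_elim]
theorem induction {n : ℕ} {P : Bar k A n → Prop} (b : Bar k A n) (zero : P 0)
    (add : ∀ x y, P x → P y → P (x + y))
    (mk : ∀ (u : Env k A) (t : ⨂[k]^n A), P (mk k A u t)) : P b :=
  TensorProduct.induction_on (motive := P) b zero mk add

/-- The universal cochain `t ↦ 1 ⊗ t`. -/
def ι (n : ℕ) : Cochain k A (Bar k A n) n :=
  (equiv k A n).symm.toLinearMap ∘ₗ TensorProduct.mk k (Env k A) (⨂[k]^n A) 1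

variable {k A} in
theorem ι_apply {n : ℕ} (t : ⨂[k]^n A) : ι k A n t = mk k A 1 t := rfl

variable {k A} in
theorem mk_eq_smul {n : ℕ} (u : Env k A) (t : ⨂[k]^n A) : mk k A u t = u • ι k A n t := by
  rw [ι_apply, smul_mk, mul_one]

section Lift

variable {k A}
variable {M M' : Type*}
  [AddCommGroup M] [Module k M] [Module (Env k A) M] [IsScalarTower k (Env k A) M]
  [AddCommGroup M'] [Module k M'] [Module (Env k A) M'] [IsScalarTower k (Env k A) M']

theorem hom_ext {n : ℕ} {φ ψ : Bar k A n →ₗ[Env k A] M}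
    (h : φ.restrictScalars k ∘ₗ ι k A n = ψ.restrictScalars k ∘ₗ ι k A n) : φ = ψ := by
  refine LinearMap.ext fun b ↦ ?_
  induction b using Bar.induction with
  | zero => simp
  | add x y hx hy => simp only [map_add, hx, hy]
  | mk u t =>
    rw [mk_eq_smul, map_smul, map_smul]
    exact congrArg _ (LinearMap.congr_fun h t)

/-- The `Aᵉ`-linear map `u ⊗ t ↦ u • f t` defined by a cochain. -/
def lift {n : ℕ} (f : Cochain k A M n) : Bar k A n →ₗ[Env k A] M where
  toFun b := TensorProduct.lift
    (LinearMap.lcomp k M f ∘ₗ (Algebra.lsmul k k M : Env k A →ₐ[k] Module.End k M).toLinearMap)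
    (equiv k A n b)
  map_add' x y := by simp only [map_add]
  map_smul' u b := by
    induction b using Bar.induction with
    | zero => simp
    | add x y hx hy => simp only [map_add, smul_add, hx, hy]
    | mk v t =>
      rw [smul_mk, equiv_mk, equiv_mk, TensorProduct.lift.tmul, TensorProduct.lift.tmul]
      exact mul_smul u v (f t)

theorem lift_mk {n : ℕ} (f : Cochain k A M n) (u : Env k A) (t : ⨂[k]^n A) :
    lift f (mk k A u t) = u • f t := rfl

@[simp] theorem lift_ι {n : ℕ} (f : Cochain k A M n) (t : ⨂[k]^n A) :
    lift f (ι k A n t) = f t := by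
  rw [ι_apply, lift_mk, one_smul]

@[simp] theorem lift_comp_ι {n : ℕ} (f : Cochain k A M n) :
    (lift f).restrictScalars k ∘ₗ ι k A n = f :=
  LinearMap.ext (lift_ι f)

variable (k A) in
/-- The differential of the bar resolution. -/
def d (n : ℕ) : Bar k A (n + 1) →ₗ[Env k A] Bar k A n :=
  lift (coboundary k A (Bar k A n) n (ι k A n))

/-- Naturality of the coboundary, the differential having been defined by the coboundary of the
universal cochain. This makes the Hochschild cochains with values in `M` the complex of `Aᵉ`-linear
maps from the bar resolution. -/
theorem comp_d {n : ℕ} (φ : Bar k A n →ₗ[Env k A] M) :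
    (φ ∘ₗ d k A n).restrictScalars k ∘ₗ ι k A (n + 1) =
      coboundary k A M n (φ.restrictScalars k ∘ₗ ι k A n) := by
  rw [coboundary_comp]
  refine LinearMap.ext fun t ↦ ?_
  change φ (d k A n (ι k A (n + 1) t)) = φ _
  rw [d, lift_ι]

theorem lift_comp_d {n : ℕ} (f : Cochain k A M n) :
    lift f ∘ₗ d k A n = lift (coboundary k A M n f) := by
  refine hom_ext ?_
  rw [comp_d, lift_comp_ι, lift_comp_ι]

theorem lift_comp_d_eq_zero {n : ℕ} {f : Cochain k A M n} (hf : f ∈ cocycles k A M n) :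
    lift f ∘ₗ d k A n = 0 := by
  rw [lift_comp_d, show coboundary k A M n f = 0 from hf]
  exact hom_ext (by rw [lift_comp_ι]; rfl)

theorem mem_cocycles {n : ℕ} {φ : Bar k A n →ₗ[Env k A] M} (h : φ ∘ₗ d k A n = 0) :
    φ.restrictScalars k ∘ₗ ι k A n ∈ cocycles k A M n := by
  change coboundary k A M n _ = 0
  rw [← comp_d, h]
  rfl

theorem mem_coboundaries {n : ℕ} (φ : Bar k A n →ₗ[Env k A] M) :
    (φ ∘ₗ d k A n).restrictScalars k ∘ₗ ι k A (n + 1) ∈ coboundaries k A M (n + 1) :=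
  ⟨_, (comp_d φ).symm⟩

end Lift

section Tau

variable {k A}
variable {N : Type*} [AddCommGroup N] [Module k N] [Module (Env k A) N]
  [IsScalarTower k (Env k A) N]

/-- `u ⊗ t ↦ (flip u • ν) ⊗ t`. -/
def toChain {n : ℕ} (ν : N) : Bar k A n →ₗ[k] Chain k A N n :=
  ((LinearMap.toSpanSingleton (Env k A) N ν).restrictScalars k ∘ₗ Env.flip k A).rTensor _ ∘ₗ
    (equiv k A n).toLinearMap

theorem toChain_mk {n : ℕ} (ν : N) (u : Env k A) (t : ⨂[k]^n A) :
    toChain ν (mk k A u t) = (Env.flip k A u • ν) ⊗ₜ t := rfl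

theorem toChain_ι {n : ℕ} (ν : N) (t : ⨂[k]^n A) :
    toChain ν (ι k A n t) = ν ⊗ₜ t := by
  rw [ι_apply, toChain_mk, Env.flip_one, one_smul]

/-- `toChain ν b` plays the role of `ν ⊗ b` in `N ⊗_{Aᵉ} Bar`, with `N` a right module through the
anti-automorphism `flip`; this is the balancing relation. -/
theorem toChain_smul {n : ℕ} (ν : N) (u : Env k A) (b : Bar k A n) :
    toChain ν (u • b) = toChain (Env.flip k A u • ν) b := by
  induction b using Bar.induction with
  | zero => simp
  | add x y hx hy => simp only [map_add, smul_add, hx, hy]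
  | mk v t => rw [smul_mk, toChain_mk, toChain_mk, Env.flip_mul, mul_smul]

theorem toChain_add_left {n : ℕ} (ν ν' : N) (b : Bar k A n) :
    toChain (ν + ν') b = toChain ν b + toChain ν' b := by
  induction b using Bar.induction with
  | zero => simp
  | add x y hx hy => simp only [map_add, hx, hy]; abel
  | mk v t => rw [toChain_mk, toChain_mk, toChain_mk, smul_add, TensorProduct.add_tmul]

theorem toChain_zero_left {n : ℕ} (b : Bar k A n) : toChain (0 : N) b = 0 := by
  have := toChain_add_left (0 : N) 0 b
  rwa [add_zero, left_eq_add] at this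

/-- The Hochschild boundary is the bar differential tensored with `N`. By `flip`, the left action on
the bar side becomes the right action on `N` and conversely, so the first and last faces correspond.
-/
theorem boundary_toChain {n : ℕ} (ν : N) (b : Bar k A (n + 1)) :
    boundary k A N n (toChain ν b) = toChain ν (d k A n b) := by
  induction b using Bar.induction with
  | zero => simp
  | add x y hx hy => simp only [map_add, hx, hy]
  | mk u t =>
    rw [mk_eq_smul, (d k A n).map_smul, toChain_smul, toChain_smul, toChain_ι, d, lift_ι]
    generalize Env.flip k A u • ν = ν'
    suffices H : boundary k A N n ∘ₗ TensorProduct.mk k N (⨂[k]^(n + 1) A) ν' =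
        toChain ν' ∘ₗ coboundary k A (Bar k A n) n (ι k A n) from LinearMap.congr_fun H t
    refine PiTensorProduct.ext (MultilinearMap.ext fun a ↦ ?_)
    simp only [LinearMap.compMultilinearMap_apply, LinearMap.comp_apply, TensorProduct.mk_apply,
      boundary_tprod, coboundary_tprod, map_add, map_sum, map_smul, toChain_ι, leftAct_apply,
      rightAct_apply, toChain_smul, Env.flip_tmul, MulOpposite.unop_one, MulOpposite.unop_op,
      MulOpposite.op_one]

/-- The map of chains induced by a map of the bar resolution. -/
def mapChain (N : Type*) [AddCommGroup N] [Module k N] [Module (Env k A) N]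
    [IsScalarTower k (Env k A) N] {n m : ℕ} (h : Bar k A n →ₗ[Env k A] Bar k A m) :
    Chain k A N n →ₗ[k] Chain k A N m :=
  TensorProduct.lift
    { toFun ν := toChain ν ∘ₗ h.restrictScalars k ∘ₗ ι k A n
      map_add' ν ν' := LinearMap.ext fun t ↦ toChain_add_left ν ν' _
      map_smul' c ν := LinearMap.ext fun t ↦ by
        have : c • ν = Env.flip k A (c • 1) • ν := by
          rw [map_smul, Env.flip_one, smul_assoc, one_smul]
        simp only [LinearMap.comp_apply, LinearMap.smul_apply, RingHom.id_apply]
        rw [this, ← toChain_smul, smul_assoc, one_smul, map_smul] }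

theorem mapChain_tmul {n m : ℕ} (h : Bar k A n →ₗ[Env k A] Bar k A m) (ν : N) (t : ⨂[k]^n A) :
    mapChain N h (ν ⊗ₜ t) = toChain ν (h (ι k A n t)) := rfl

theorem mapChain_toChain {n m : ℕ} (h : Bar k A n →ₗ[Env k A] Bar k A m) (ν : N)
    (b : Bar k A n) : mapChain N h (toChain ν b) = toChain ν (h b) := by
  induction b using Bar.induction with
  | zero => simp
  | add x y hx hy => simp only [map_add, hx, hy]
  | mk u t => rw [mk_eq_smul, toChain_smul, toChain_ι, mapChain_tmul, map_smul, toChain_smul]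

theorem mapChain_d (n : ℕ) : mapChain N (d k A n) = boundary k A N n := by
  refine TensorProduct.ext' fun ν t ↦ ?_
  rw [mapChain_tmul, ← boundary_toChain, toChain_ι]

theorem mapChain_comp {n m l : ℕ} (h' : Bar k A m →ₗ[Env k A] Bar k A l)
    (h : Bar k A n →ₗ[Env k A] Bar k A m) :
    mapChain N (h' ∘ₗ h) = mapChain N h' ∘ₗ mapChain N h := by
  refine TensorProduct.ext' fun ν t ↦ ?_
  rw [LinearMap.comp_apply, mapChain_tmul, mapChain_tmul, mapChain_toChain, LinearMap.comp_apply]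

theorem mapChain_id (n : ℕ) :
    mapChain N (LinearMap.id : Bar k A n →ₗ[Env k A] Bar k A n) = LinearMap.id := by
  refine TensorProduct.ext' fun ν t ↦ ?_
  rw [mapChain_tmul, LinearMap.id_apply, toChain_ι, LinearMap.id_apply]

theorem mapChain_add {n m : ℕ} (h h' : Bar k A n →ₗ[Env k A] Bar k A m) :
    mapChain N (h + h') = mapChain N h + mapChain N h' := by
  refine TensorProduct.ext' fun ν t ↦ ?_
  rw [LinearMap.add_apply, mapChain_tmul, mapChain_tmul, mapChain_tmul, LinearMap.add_apply,
    map_add]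

theorem mapChain_zero {n m : ℕ} :
    mapChain N (0 : Bar k A n →ₗ[Env k A] Bar k A m) = 0 := by
  refine TensorProduct.ext' fun ν t ↦ ?_
  rw [mapChain_tmul, LinearMap.zero_apply, map_zero, LinearMap.zero_apply]

end Tau

section Exactness

/-- The inverse of `toChain 1 : Bar n → C_n(A, Aᵉ)`. -/
def ofChain (n : ℕ) : Chain k A (Env k A) n →ₗ[k] Bar k A n :=
  (equiv k A n).symm.toLinearMap ∘ₗ (Env.flip k A).rTensor _

variable {k A}

theorem ofChain_tmul {n : ℕ} (u : Env k A) (t : ⨂[k]^n A) :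
    ofChain k A n (u ⊗ₜ t) = mk k A (Env.flip k A u) t := rfl

theorem ofChain_toChain {n : ℕ} (b : Bar k A n) :
    ofChain k A n (toChain (1 : Env k A) b) = b := by
  induction b using Bar.induction with
  | zero => simp
  | add x y hx hy => simp only [map_add, hx, hy]
  | mk u t => rw [toChain_mk, ofChain_tmul, smul_eq_mul, mul_one, Env.flip_flip]

theorem toChain_ofChain {n : ℕ} (z : Chain k A (Env k A) n) :
    toChain (1 : Env k A) (ofChain k A n z) = z := by
  induction z using TensorProduct.induction_on with
  | zero => simp
  | add x y hx hy => simp only [map_add, hx, hy]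
  | tmul u t => rw [ofChain_tmul, toChain_mk, smul_eq_mul, mul_one, Env.flip_flip]

variable (k A) in
/-- The contracting homotopy of the bar resolution. -/
def homotopy (n : ℕ) : Bar k A n →ₗ[k] Bar k A (n + 1) :=
  ofChain k A (n + 1) ∘ₗ contraction (Env.splitting k A) n ∘ₗ toChain (1 : Env k A)

/-- The bar complex is the Hochschild chain complex of `Aᵉ`, up to `flip`; hence the contraction
built from `Env.splitting` carries over. -/
theorem d_eq {n : ℕ} (b : Bar k A (n + 1)) :
    d k A n b = ofChain k A n (boundary k A _ n (toChain (1 : Env k A) b)) := by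
  rw [boundary_toChain, ofChain_toChain]

theorem d_homotopy_succ {n : ℕ} (b : Bar k A (n + 1)) :
    d k A (n + 1) (homotopy k A (n + 1) b) = b - homotopy k A n (d k A n b) := by
  rw [d_eq]
  simp only [homotopy, LinearMap.comp_apply]
  rw [toChain_ofChain, boundary_contraction_succ _ (Env.rightMul_splitting k A)
    (Env.splitting_leftAct k A) (Env.splitting_rightAct k A), map_sub, ofChain_toChain,
    boundary_toChain]

variable (k A) in
/-- The augmentation of the bar resolution. -/
def augmentation : Bar k A 0 →ₗ[Env k A] Regular k A :=
  lift (LinearMap.toSpanSingleton k (Regular k A) ((Regular.equiv k A).symm 1) ∘ₗ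
    (PiTensorProduct.isEmptyEquiv (Fin 0)).toLinearMap)

theorem augmentation_mk (x : A) (y : Aᵐᵒᵖ) (a : Fin 0 → A) :
    Regular.equiv k A (augmentation k A (mk k A (x ⊗ₜ y) (PiTensorProduct.tprod k a))) =
      x * y.unop := by
  rw [augmentation, lift_mk, Regular.equiv_smul]
  simp

theorem bar_zero_eq (b : Bar k A 0) :
    ∃ u : Env k A, b = mk k A u (PiTensorProduct.tprod k (Fin.elim0 : Fin 0 → A)) := by
  obtain ⟨m, hm⟩ := chain_zero_eq (toChain (1 : Env k A) b)
  refine ⟨Env.flip k A m, ?_⟩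
  rw [← ofChain_toChain b, hm, ofChain_tmul]

/-- In degree `0` the homotopy misses the identity by the augmentation followed by its section `a ↦
1 ⊗ a`. -/
theorem d_homotopy_zero (b : Bar k A 0) :
    d k A 0 (homotopy k A 0 b) = b - mk k A
      (1 ⊗ₜ MulOpposite.op (Regular.equiv k A (augmentation k A b)))
        (PiTensorProduct.tprod k (Fin.elim0 : Fin 0 → A)) := by
  obtain ⟨u, rfl⟩ := bar_zero_eq b
  rw [d_eq]
  simp only [homotopy, LinearMap.comp_apply]
  rw [toChain_ofChain, toChain_mk, boundary_contraction_zero _ (Env.rightMul_splitting k A),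
    map_sub, ofChain_tmul, ofChain_tmul, smul_eq_mul, mul_one, Env.flip_flip]
  congr 1
  induction u using Env.induction with
  | zero =>
    have h₁ : mk k A (0 : Env k A) (PiTensorProduct.tprod k (Fin.elim0 : Fin 0 → A)) = 0 := by
      rw [mk, TensorProduct.zero_tmul, map_zero]
    have h₂ : Env.flip k A (0 : Env k A) = 0 := map_zero _
    rw [h₁, h₂]
    simp only [map_zero, MulOpposite.op_zero, TensorProduct.tmul_zero]
  | add x y hx hy =>
    have h (u v : Env k A) (t : ⨂[k]^0 A) : mk k A (u + v) t = mk k A u t + mk k A v t := by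
      simp only [mk, TensorProduct.add_tmul, map_add]
    simp only [map_add, h, hx, hy, MulOpposite.op_add, TensorProduct.tmul_add]
  | tmul x y =>
    rw [augmentation_mk, Env.flip_tmul, Env.splitting_tmul, TensorProduct.comm_tmul,
      leftMul_tmul, leftAct_apply, smul_eq_mul, Algebra.TensorProduct.tmul_mul_tmul,
      Env.flip_tmul, mul_one, MulOpposite.unop_one, MulOpposite.unop_op]

theorem augmentation_surjective : Function.Surjective (augmentation k A) := fun a ↦
  ⟨mk k A (Regular.equiv k A a ⊗ₜ 1) (PiTensorProduct.tprod k (Fin.elim0 : Fin 0 → A)), by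
    apply (Regular.equiv k A).injective
    rw [augmentation_mk]
    simp⟩

theorem augmentation_comp_d : augmentation k A ∘ₗ d k A 0 = 0 := by
  refine hom_ext ?_
  rw [comp_d, augmentation, lift_comp_ι]
  refine PiTensorProduct.ext (MultilinearMap.ext fun a ↦ ?_)
  apply (Regular.equiv k A).injective
  simp [coboundary_tprod, Regular.equiv_leftAct, Regular.equiv_rightAct]

theorem ι_eq_homotopy {n : ℕ} (a : Fin (n + 1) → A) :
    ι k A (n + 1) (PiTensorProduct.tprod k a) = homotopy k A n
      (mk k A (a 0 ⊗ₜ[k] (1 : Aᵐᵒᵖ)) (PiTensorProduct.tprod k (Fin.tail a))) := by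
  simp only [homotopy, LinearMap.comp_apply]
  rw [toChain_mk, smul_eq_mul, mul_one, contraction_tmul, Env.flip_tmul, MulOpposite.unop_one,
    Env.splitting_tmul, Chain.cons_tmul, ofChain_tmul, ι_apply, Env.flip_tmul, MulOpposite.unop_one,
    MulOpposite.unop_op, Fin.cons_self_tail]
  rfl

/-- Induction on degree through the homotopy `h`, without expanding faces: generators lie in the
image of `h`, and there `d d h = d - d h d`, while `d h d = d` follows from `d d = 0` one degree
lower, or from the augmentation at the bottom. -/
theorem d_comp_d (n : ℕ) : d k A n ∘ₗ d k A (n + 1) = 0 := by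
  suffices H : ∀ b : Bar k A (n + 1), d k A n b = d k A n (homotopy k A n (d k A n b)) by
    refine hom_ext (PiTensorProduct.ext (MultilinearMap.ext fun a ↦ ?_))
    simp only [LinearMap.compMultilinearMap_apply, LinearMap.comp_apply,
      LinearMap.coe_restrictScalars, LinearMap.zero_apply]
    rw [ι_eq_homotopy, d_homotopy_succ, map_sub, sub_eq_zero]
    exact H _
  intro b
  cases n with
  | zero =>
    have h : augmentation k A (d k A 0 b) = 0 := LinearMap.congr_fun augmentation_comp_d b
    rw [d_homotopy_zero, h, map_zero, MulOpposite.op_zero, TensorProduct.tmul_zero, mk,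
      TensorProduct.zero_tmul, map_zero, sub_zero]
  | succ n =>
    have h : d k A n (d k A (n + 1) b) = 0 := LinearMap.congr_fun (d_comp_d n) b
    rw [d_homotopy_succ, h, map_zero, sub_zero]

theorem exact_succ (n : ℕ) : Function.Exact (d k A (n + 1)) (d k A n) := by
  intro b
  constructor
  · intro hb
    refine ⟨homotopy k A (n + 1) b, ?_⟩
    rw [d_homotopy_succ, hb, map_zero, sub_zero]
  · rintro ⟨c, rfl⟩
    exact LinearMap.congr_fun (d_comp_d n) c

theorem exact_zero : Function.Exact (d k A 0) (augmentation k A) := by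
  intro b
  constructor
  · intro hb
    refine ⟨homotopy k A 0 b, ?_⟩
    rw [d_homotopy_zero, hb, map_zero, MulOpposite.op_zero, TensorProduct.tmul_zero, mk,
      TensorProduct.zero_tmul, map_zero, sub_zero]
  · rintro ⟨c, rfl⟩
    exact LinearMap.congr_fun augmentation_comp_d c

end Exactness

end Bar

end BarComplex

/-! ### Comparison with a degreewise finitely generated projective resolution. -/

section Resolution

open CategoryTheory

variable (k A : Type u) [Field k] [Ring A] [Algebra k A]

/-- The bar complex as a chain complex of `Aᵉ`-modules. -/
def barComplex : ChainComplex (ModuleCat.{u} (Env k A)) ℕ :=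
  ChainComplex.of (fun n ↦ ModuleCat.of (Env k A) (Bar k A n))
    (fun n ↦ ModuleCat.ofHom (Bar.d k A n))
    (fun n ↦ by rw [← ModuleCat.ofHom_comp, Bar.d_comp_d]; rfl)

theorem barComplex_d (n : ℕ) :
    (barComplex k A).d (n + 1) n = ModuleCat.ofHom (Bar.d k A n) := by
  simp [barComplex]

theorem barComplex_exactAt_succ (n : ℕ) : (barComplex k A).ExactAt (n + 1) := by
  rw [HomologicalComplex.exactAt_iff' _ (n + 1 + 1) (n + 1) n (by simp) (by simp),
    ShortComplex.ShortExact.moduleCat_exact_iff_function_exact]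
  change Function.Exact ((barComplex k A).d (n + 1 + 1) (n + 1)) ((barComplex k A).d (n + 1) n)
  rw [barComplex_d, barComplex_d]
  exact Bar.exact_succ n

/-- The augmentation, as a morphism from the degree `0` part of the bar complex. -/
def barAugmentation : (barComplex k A).X 0 ⟶ ModuleCat.of (Env k A) (Regular k A) :=
  ModuleCat.ofHom (Bar.augmentation k A)

theorem barComplex_d_comp_augmentation :
    (barComplex k A).d 1 0 ≫ barAugmentation k A = 0 := by
  rw [barComplex_d]
  exact ModuleCat.hom_ext Bar.augmentation_comp_d

/-- The bar resolution. -/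
def barResolution : ProjectiveResolution (ModuleCat.of (Env k A) (Regular k A)) where
  complex := barComplex k A
  projective n := by
    have : Module.Projective (Env k A) ((barComplex k A).X n) :=
      inferInstanceAs (Module.Projective (Env k A) (Bar k A n))
    exact ModuleCat.projective_of_categoryTheory_projective _
  π := (ChainComplex.toSingle₀Equiv _ _).symm
    ⟨barAugmentation k A, barComplex_d_comp_augmentation k A⟩
  quasiIso := ⟨fun n ↦ by
    cases n with
    | zero =>
      -- In degree `0` the quasi-isomorphism condition amounts to exactness at `Bar 0` and
      -- surjectivity of the augmentation.
      rw [ChainComplex.quasiIsoAt₀_iff, ShortComplex.quasiIso_iff_of_zeros']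
      · refine (ShortComplex.exact_and_epi_g_iff_of_iso
          (S₂ := ShortComplex.mk _ _ (barComplex_d_comp_augmentation k A)) ?_).2 ⟨?_, ?_⟩
        · exact ShortComplex.isoMk (Iso.refl _) (Iso.refl _) (Iso.refl _)
            ((Category.id_comp _).trans (Category.comp_id _).symm)
            (by
              simp only [Iso.refl_hom]
              exact (Category.id_comp (barAugmentation k A)).trans (Category.comp_id _).symm)
        · rw [ShortComplex.ShortExact.moduleCat_exact_iff_function_exact]
          change Function.Exact ((barComplex k A).d 1 0) (barAugmentation k A)
          rw [barComplex_d]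
          exact Bar.exact_zero
        · exact (ModuleCat.epi_iff_surjective _).2 Bar.augmentation_surjective
      all_goals rfl
    | succ n =>
      rw [quasiIsoAt_iff_exactAt']
      · exact barComplex_exactAt_succ k A n
      · exact ChainComplex.exactAt_succ_single_obj _ _⟩

/-- A degreewise finitely generated projective complex of `Aᵉ`-modules homotopy equivalent to the
bar resolution, whose cohomology vanishes in degrees above `d`. -/
structure FiniteModel (d : ℕ) where
  /-- The terms of the complex. -/
  X : ℕ → ModuleCat.{u} (Env k A)
  finite (n : ℕ) : Module.Finite (Env k A) (X n)
  projective (n : ℕ) : Module.Projective (Env k A) (X n)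
  /-- The differentials of the complex. -/
  δ (n : ℕ) : X (n + 1) →ₗ[Env k A] X n
  δ_comp_δ (n : ℕ) : δ n ∘ₗ δ (n + 1) = 0
  /-- The map from the bar resolution. -/
  f (n : ℕ) : Bar k A n →ₗ[Env k A] X n
  /-- The map to the bar resolution. -/
  g (n : ℕ) : X n →ₗ[Env k A] Bar k A n
  f_comp_d (n : ℕ) : f n ∘ₗ Bar.d k A n = δ n ∘ₗ f (n + 1)
  d_comp_g (n : ℕ) : Bar.d k A n ∘ₗ g (n + 1) = g n ∘ₗ δ n
  /-- The homotopy between the identity and the composite of the two comparison maps. -/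
  h (n : ℕ) : Bar k A n →ₗ[Env k A] Bar k A (n + 1)
  g_comp_f_zero : g 0 ∘ₗ f 0 = Bar.d k A 0 ∘ₗ h 0 + LinearMap.id
  g_comp_f_succ (n : ℕ) : g (n + 1) ∘ₗ f (n + 1) =
    h n ∘ₗ Bar.d k A n + Bar.d k A (n + 1) ∘ₗ h (n + 1) + LinearMap.id
  vanishing (n : ℕ) (hn : d ≤ n) (M : ModuleCat.{u} (Env k A)) (φ : X (n + 1) →ₗ[Env k A] M)
    (hφ : φ ∘ₗ δ (n + 1) = 0) : ∃ ψ : X n →ₗ[Env k A] M, ψ ∘ₗ δ n = φ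

/-- Two projective resolutions of `A` are homotopy equivalent. Type FP supplies finite generation in
each degree; the vanishing above `d` comes from the projective dimension, and the length of the
given resolution plays no role. -/
theorem exists_finiteModel {d : ℕ} (hA : IsOfTypeFP (ModuleCat.of (Env k A) (Regular k A)))
    (hd : projectiveDimension (ModuleCat.of (Env k A) (Regular k A)) ≤ d) :
    Nonempty (FiniteModel k A d) := by
  obtain ⟨P, hP, -⟩ := hA
  have hd' := (projectiveDimension_le_iff _ _).1 hd
  let e := ProjectiveResolution.homotopyEquiv (barResolution k A) P
  have hB (n : ℕ) : (barResolution k A).complex.d (n + 1) n = ModuleCat.ofHom (Bar.d k A n) :=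
    barComplex_d k A n
  have hcomm (n : ℕ) := e.homotopyHomInvId.comm n
  exact ⟨{
    X := P.complex.X
    finite := hP
    projective n := (IsProjective.iff_projective _).2 (P.projective n)
    δ n := (P.complex.d (n + 1) n).hom
    δ_comp_δ n := congrArg ModuleCat.Hom.hom (P.complex.d_comp_d (n + 2) (n + 1) n)
    f n := (e.hom.f n).hom
    g n := (e.inv.f n).hom
    f_comp_d n := by
      have := congrArg ModuleCat.Hom.hom (e.hom.comm (n + 1) n)
      rw [hB] at this
      exact this.symm
    d_comp_g n := by
      have := congrArg ModuleCat.Hom.hom (e.inv.comm (n + 1) n)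
      rw [hB] at this
      exact this
    h n := (e.homotopyHomInvId.hom n (n + 1)).hom
    g_comp_f_zero := by
      have := hcomm 0
      rw [Homotopy.dNext_zero_chainComplex, Homotopy.prevD_chainComplex, hB, zero_add] at this
      exact congrArg ModuleCat.Hom.hom this
    g_comp_f_succ n := by
      have := hcomm (n + 1)
      rw [Homotopy.dNext_succ_chainComplex, Homotopy.prevD_chainComplex, hB, hB] at this
      exact congrArg ModuleCat.Hom.hom this
    vanishing n hn M φ hφ := by
      have hφ' : P.complex.d (n + 2) (n + 1) ≫ ModuleCat.ofHom φ = 0 := ModuleCat.hom_ext hφ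
      -- The cocycle `φ` defines a class in `Ext` of degree `n + 1 ≥ d + 1`, where `Ext` vanishes;
      -- so `φ` extends along the differential.
      have h0 : P.extMk (ModuleCat.ofHom φ) (n + 2) rfl hφ' = 0 :=
        Abelian.Ext.eq_zero_of_hasProjectiveDimensionLT _ (d + 1) (by omega)
      obtain ⟨ψ, hψ⟩ := (P.extMk_eq_zero_iff _ _ rfl hφ' n rfl).1 h0
      exact ⟨ψ.hom, congrArg ModuleCat.Hom.hom hψ⟩ }⟩

end Resolution

/-! ### Free bimodules, possibly of infinite rank. -/

section Coordinates

variable (k A : Type*) [Field k] [Ring A] [Algebra k A]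

/-- The structure of a direct sum of copies of `Aᵉ` on an `Aᵉ`-module. -/
structure FreeCoordinates (ι F : Type*) [AddCommGroup F] [Module (Env k A) F] where
  /-- The inclusions of the summands. -/
  incl (j : ι) : Env k A →ₗ[Env k A] F
  /-- The coordinates. -/
  coord (j : ι) : F →ₗ[Env k A] Env k A
  /-- A finite set of indices outside of which the coordinates of an element vanish. -/
  support (x : F) : Finset ι
  sum_incl_coord (J : Finset ι) (x : F) (hx : support x ⊆ J) : ∑ j ∈ J, incl j (coord j x) = x

/-- The coordinates on `ι →₀ Aᵉ`. -/
def FreeCoordinates.finsupp (ι : Type*) : FreeCoordinates k A ι (ι →₀ Env k A) where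
  incl j := Finsupp.lsingle j
  coord j := Finsupp.lapply j
  support x := x.support
  sum_incl_coord J x hx := by
    conv_rhs => rw [← Finsupp.sum_single x]
    exact (Finsupp.sum_of_support_subset _ hx _ (by simp)).symm

end Coordinates

/-! ### Cohomology computed through the finite model. -/

section FiniteModel

variable {k A : Type u} [Field k] [Ring A] [Algebra k A] {d : ℕ} (X : FiniteModel k A d)

attribute [instance] FiniteModel.finite FiniteModel.projective

namespace FiniteModel

theorem f_comp_d_apply (n : ℕ) (b : Bar k A (n + 1)) :
    X.f n (Bar.d k A n b) = X.δ n (X.f (n + 1) b) := LinearMap.congr_fun (X.f_comp_d n) b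

theorem d_comp_g_apply (n : ℕ) (x : X.X (n + 1)) :
    Bar.d k A n (X.g (n + 1) x) = X.g n (X.δ n x) := LinearMap.congr_fun (X.d_comp_g n) x

section Coefficients

variable {M : Type*} [AddCommGroup M] [Module k M] [Module (Env k A) M]
  [IsScalarTower k (Env k A) M]

/-- Every cocycle is cohomologous to one that factors through the finite model. -/
theorem comp_sub_mem_coboundaries {p : ℕ} {φ : Bar k A p →ₗ[Env k A] M}
    (hφ : φ ∘ₗ Bar.d k A p = 0) :
    (φ ∘ₗ X.g p ∘ₗ X.f p).restrictScalars k ∘ₗ Bar.ι k A p - φ.restrictScalars k ∘ₗ Bar.ι k A p ∈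
      coboundaries k A M p := by
  have hφ' (b) : φ (Bar.d k A p b) = 0 := LinearMap.congr_fun hφ b
  cases p with
  | zero =>
    -- There are no nonzero coboundaries in degree `0`, so equality is needed; it holds because the
    -- homotopy contributes only `d ∘ h`, which `φ` kills.
    have : φ ∘ₗ X.g 0 ∘ₗ X.f 0 = φ := by
      rw [X.g_comp_f_zero]
      refine LinearMap.ext fun b ↦ ?_
      simp [hφ']
    rw [this, sub_self]
    exact Submodule.zero_mem _
  | succ p =>
    have : φ ∘ₗ X.g (p + 1) ∘ₗ X.f (p + 1) = (φ ∘ₗ X.h p) ∘ₗ Bar.d k A p + φ := by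
      rw [X.g_comp_f_succ]
      refine LinearMap.ext fun b ↦ ?_
      simp [hφ']
    rw [this]
    convert Bar.mem_coboundaries (φ ∘ₗ X.h p) using 1
    refine LinearMap.ext fun t ↦ ?_
    simp

end Coefficients

/-- Transported to `X`, the cocycle becomes a coboundary by the bound on projective dimension.
Pulling this back gives the original cocycle up to a coboundary. -/
theorem mem_coboundaries_of_lt (X : FiniteModel k A d) {M : Type u} [AddCommGroup M]
    [Module k M] [Module (Env k A) M]
    [IsScalarTower k (Env k A) M] {p : ℕ} (hp : d < p) {c : Cochain k A M p}
    (hc : c ∈ cocycles k A M p) : c ∈ coboundaries k A M p := by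
  obtain ⟨p, rfl⟩ : ∃ p', p = p' + 1 := ⟨p - 1, by omega⟩
  have hφ := Bar.lift_comp_d_eq_zero hc
  have h₁ : (Bar.lift c ∘ₗ X.g (p + 1)) ∘ₗ X.δ (p + 1) = 0 := by
    rw [LinearMap.comp_assoc, ← X.d_comp_g, ← LinearMap.comp_assoc, hφ, LinearMap.zero_comp]
  obtain ⟨ψ, hψ⟩ := X.vanishing p (by omega) (ModuleCat.of _ M) _ h₁
  have h₂ := X.comp_sub_mem_coboundaries hφ
  rw [Bar.lift_comp_ι, ← LinearMap.comp_assoc, ← hψ, LinearMap.comp_assoc, ← X.f_comp_d,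
    ← LinearMap.comp_assoc] at h₂
  have := Submodule.sub_mem _ (Bar.mem_coboundaries (ψ ∘ₗ X.f p)) h₂
  rwa [sub_sub_cancel] at this

variable {ι F : Type*} [AddCommGroup F] [Module k F] [Module (Env k A) F]
  [IsScalarTower k (Env k A) F]

/-- Cohomology commutes with direct sums of copies of `Aᵉ`. -/
theorem exists_finset_sub_mem_coboundaries (X : FiniteModel k A d) (e : FreeCoordinates k A ι F)
    [DecidableEq ι] {p : ℕ}
    {c : Cochain k A F p} (hc : c ∈ cocycles k A _ p) :
    ∃ J : Finset ι, c - (∑ j ∈ J, (e.incl j).restrictScalars k ∘ₗ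
      (e.coord j).restrictScalars k ∘ₗ c : Cochain k A F p) ∈ coboundaries k A _ p := by
  have hφ := Bar.lift_comp_d_eq_zero hc
  obtain ⟨S, hS⟩ := (X.finite p).fg_top
  set φ := Bar.lift c with hφdef
  -- `J` collects the coordinates met by the images of finitely many generators of `X p`. So `π`
  -- fixes the image of `φ ∘ g`, and both `c` and `π ∘ c` are cohomologous to `φ ∘ g ∘ f`.
  let J : Finset ι := S.biUnion fun s ↦ e.support (φ (X.g p s))
  let π : F →ₗ[Env k A] F :=
    ∑ j ∈ J, e.incl j ∘ₗ e.coord j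
  have he : π ∘ₗ φ ∘ₗ X.g p = φ ∘ₗ X.g p := by
    refine LinearMap.ext_on hS fun s hs ↦ ?_
    simp only [LinearMap.comp_apply, π, LinearMap.sum_apply]
    exact e.sum_incl_coord J _ (Finset.subset_biUnion_of_mem (fun s ↦ e.support (φ (X.g p s))) hs)
  refine ⟨J, ?_⟩
  have h₁ := X.comp_sub_mem_coboundaries hφ
  have h₂ := map_mem_coboundaries π h₁
  have h₃ := Submodule.sub_mem _ h₂ h₁
  convert h₃ using 1
  have hc' : φ.restrictScalars k ∘ₗ Bar.ι k A p = c := Bar.lift_comp_ι c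
  rw [hc', LinearMap.comp_sub]
  have h₄ : π.restrictScalars k ∘ₗ (φ ∘ₗ X.g p ∘ₗ X.f p).restrictScalars k ∘ₗ Bar.ι k A p =
      (φ ∘ₗ X.g p ∘ₗ X.f p).restrictScalars k ∘ₗ Bar.ι k A p :=
    LinearMap.ext fun t ↦ LinearMap.congr_fun he (X.f p (Bar.ι k A p t))
  rw [h₄]
  have h₅ : ∑ j ∈ J, (e.incl j).restrictScalars k ∘ₗ
      (e.coord j).restrictScalars k ∘ₗ c = π.restrictScalars k ∘ₗ c := by
    refine LinearMap.ext fun t ↦ ?_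
    simp [π, LinearMap.sum_apply]
  rw [h₅]
  abel

end FiniteModel

end FiniteModel

/-! ### Homology with free coefficients, reduced to finitely many coordinates. -/

section FreeHomology

variable {k A : Type*} [Field k] [Ring A] [Algebra k A]
variable {N : Type*} [AddCommGroup N] [Module k N] [Module (Env k A) N]
  [IsScalarTower k (Env k A) N]
variable {ι F : Type*} [AddCommGroup F] [Module k F] [Module (Env k A) F]
  [IsScalarTower k (Env k A) F] (e : FreeCoordinates k A ι F)

/-- Allowing every larger `J` is what lets the finite sets of two summands be merged. -/
theorem BTensor.exists_finset_eq_sum [DecidableEq ι] (t : BTensor k A N F) :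
    ∃ J₀ : Finset ι, ∀ J, J₀ ⊆ J → t = ∑ j ∈ J,
      BTensor.map N (e.incl j)
        (BTensor.map N (e.coord j) t) := by
  refine BTensor.induction t ⟨∅, fun J _ ↦ by simp⟩ ?_ fun n x ↦ ⟨e.support x, fun J hJ ↦ ?_⟩
  · rintro x y ⟨J₁, h₁⟩ ⟨J₂, h₂⟩
    refine ⟨J₁ ∪ J₂, fun J hJ ↦ ?_⟩
    simp only [map_add, Finset.sum_add_distrib]
    rw [← h₁ J (Finset.union_subset_left hJ), ← h₂ J (Finset.union_subset_right hJ)]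
  · simp only [BTensor.map_proj]
    rw [← map_sum, ← TensorProduct.tmul_sum]
    congr 2
    exact (e.sum_incl_coord J x hJ).symm

theorem Chain.exists_finset_eq_sum [DecidableEq ι] {q : ℕ}
    (z : Chain k A (BTensor k A N F) q) :
    ∃ J₀ : Finset ι, ∀ J, J₀ ⊆ J → z = ∑ j ∈ J,
      Chain.map k A (BTensor.map N (e.incl j)) q
        (Chain.map k A (BTensor.map N (e.coord j)) q z) := by
  induction z using TensorProduct.induction_on with
  | zero => exact ⟨∅, fun J _ ↦ by simp⟩
  | add x y hx hy =>
    obtain ⟨J₁, h₁⟩ := hx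
    obtain ⟨J₂, h₂⟩ := hy
    refine ⟨J₁ ∪ J₂, fun J hJ ↦ ?_⟩
    simp only [map_add, Finset.sum_add_distrib]
    rw [← h₁ J (Finset.union_subset_left hJ), ← h₂ J (Finset.union_subset_right hJ)]
  | tmul t a =>
    obtain ⟨J₀, h⟩ := BTensor.exists_finset_eq_sum e t
    refine ⟨J₀, fun J hJ ↦ ?_⟩
    simp only [Chain.map_tmul]
    rw [← TensorProduct.sum_tmul, ← h J hJ]

/-- `H_n(A, N ⊗_A F) = 0` for `n > 0` and `F` free. -/
theorem BTensor.mem_boundaries_succ_of_free (e : FreeCoordinates k A ι F) {q : ℕ}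
    {z : Chain k A (BTensor k A N F) (q + 1)} (hz : z ∈ cycles k A _ (q + 1)) :
    z ∈ boundaries k A _ (q + 1) := by
  classical
  obtain ⟨J, hJ⟩ := Chain.exists_finset_eq_sum e z
  rw [hJ J subset_rfl]
  exact Submodule.sum_mem _ fun j _ ↦ Chain.map_mem_boundaries _
    (BTensor.mem_boundaries_succ (Chain.map_mem_cycles _ hz))

end FreeHomology

theorem exists_dualBasis (R M : Type*) [Ring R] [AddCommGroup M] [Module R M] [Module.Finite R M]
    [Module.Projective R M] : ∃ (n : ℕ) (p : Fin n → M) (p' : Fin n → M →ₗ[R] R),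
      ∀ x, ∑ i, p' i x • p i = x := by
  obtain ⟨n, s, r, -, -, h⟩ := Module.Finite.exists_comp_eq_id_of_projective R M
  refine ⟨n, fun i ↦ s (Pi.single i 1), fun i ↦ LinearMap.proj i ∘ₗ r, fun x ↦ ?_⟩
  have hx : s (r x) = x := LinearMap.congr_fun h x
  conv_rhs => rw [← hx, pi_eq_sum_univ' (r x)]
  simp only [map_sum, map_smul, LinearMap.comp_apply, LinearMap.proj_apply]

/-! ### Cocycle representatives of classes. -/

section CohomologyClass

variable {k A : Type*} [Field k] [Ring A] [Algebra k A]
variable {M : Type*} [AddCommGroup M] [Module k M] [Module (Env k A) M]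
  [IsScalarTower k (Env k A) M]

/-- The cohomology class of a cocycle. -/
def cohomologyClass {n : ℕ} (f : Cochain k A M n) (hf : f ∈ cocycles k A M n) :
    Cohomology k A M n := Submodule.Quotient.mk ⟨f, hf⟩

theorem exists_cohomologyClass_eq {n : ℕ} (α : Cohomology k A M n) :
    ∃ (f : Cochain k A M n) (hf : f ∈ cocycles k A M n), cohomologyClass f hf = α := by
  obtain ⟨f, rfl⟩ := Submodule.Quotient.mk_surjective _ α
  exact ⟨f, f.2, rfl⟩

theorem cohomologyClass_eq_iff {n : ℕ} {f g : Cochain k A M n} {hf : f ∈ cocycles k A M n}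
    {hg : g ∈ cocycles k A M n} :
    cohomologyClass f hf = cohomologyClass g hg ↔ f - g ∈ coboundaries k A M n :=
  Submodule.Quotient.eq _

theorem cohomologyClass_eq_zero_iff {n : ℕ} {f : Cochain k A M n} {hf : f ∈ cocycles k A M n} :
    cohomologyClass f hf = 0 ↔ f ∈ coboundaries k A M n :=
  Submodule.Quotient.mk_eq_zero _

end CohomologyClass

/-! ### Capping a `d`-chain with a `d`-cochain valued in `Aᵉ`. -/

section Evaluation

variable {k A : Type*} [Field k] [Ring A] [Algebra k A]
variable {N : Type*} [AddCommGroup N] [Module k N] [Module (Env k A) N]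
  [IsScalarTower k (Env k A) N]

theorem Bar.toChain_sum_left {α : Type*} {n : ℕ} (s : Finset α) (ν : α → N) (b : Bar k A n) :
    Bar.toChain (∑ i ∈ s, ν i) b = ∑ i ∈ s, Bar.toChain (ν i) b := by
  classical
  induction s using Finset.induction_on with
  | empty => simp [Bar.toChain_zero_left]
  | insert i s hi ih => rw [Finset.sum_insert hi, Finset.sum_insert hi, toChain_add_left, ih]

theorem evalChain_capChain {d : ℕ} (ν : N) (t : ⨂[k]^d A) (f : Cochain k A (Env k A) d) :
    evalChain k A N (capChain (Nat.add_zero d) (ν ⊗ₜ t) f) =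
      (-1 : k) ^ (d * d) • Env.flip k A (f t) • ν := by
  suffices H : evalChain k A N ∘ₗ (capChain (Nat.add_zero d)).flip f ∘ₗ
      TensorProduct.mk k N (⨂[k]^d A) ν = (-1 : k) ^ (d * d) •
        ((LinearMap.toSpanSingleton (Env k A) N ν).restrictScalars k ∘ₗ Env.flip k A ∘ₗ f) from
    LinearMap.congr_fun H t
  refine PiTensorProduct.ext (MultilinearMap.ext fun a ↦ ?_)
  simp only [LinearMap.compMultilinearMap_apply, LinearMap.comp_apply, LinearMap.flip_apply,
    TensorProduct.mk_apply, capChain_tprod, map_smul, evalChain_tprod, evalTensor_proj,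
    LinearMap.smul_apply]
  rfl

/-- In terms of `N ⊗_{Aᵉ} Bar`, the cap product followed by the identification with `N` is the
contraction `ν ⊗ b ↦ ν · φ(b)`, up to sign. -/
theorem evalChain_capChain_toChain {d : ℕ} (ν : N) (b : Bar k A d)
    (φ : Bar k A d →ₗ[Env k A] Env k A) :
    evalChain k A N (capChain (Nat.add_zero d) (Bar.toChain ν b)
      (φ.restrictScalars k ∘ₗ Bar.ι k A d)) = (-1 : k) ^ (d * d) • Env.flip k A (φ b) • ν := by
  induction b using Bar.induction with
  | zero =>
    have : Env.flip k A (0 : Env k A) • ν = 0 := by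
      rw [map_zero (Env.flip k A)]; exact Module.zero_smul ν
    simp only [map_zero, LinearMap.zero_apply]
    rw [map_zero] at this
    rw [this, smul_zero]
  | add x y hx hy => simp only [map_add, LinearMap.add_apply, hx, hy, add_smul, smul_add]
  | mk u t =>
    rw [Bar.mk_eq_smul, Bar.toChain_smul, Bar.toChain_ι, evalChain_capChain, φ.map_smul,
      smul_eq_mul, Env.flip_mul, mul_smul]
    rfl

end Evaluation

/-! ### Existence and uniqueness of the fundamental class. -/

section FundamentalClass

variable {k A : Type u} [Field k] [Ring A] [Algebra k A] {d : ℕ}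

/-- The class in `𝒟` of a functional on a module `Y`, pulled back along `f : Bar d → Y`. -/
def dualClass {Y : Type*} [AddCommGroup Y] [Module (Env k A) Y] (f : Bar k A d →ₗ[Env k A] Y)
    (hf : f ∘ₗ Bar.d k A d = 0) : (Y →ₗ[Env k A] Env k A) →+ Dualizing k A d where
  toFun q := cohomologyClass ((q ∘ₗ f).restrictScalars k ∘ₗ Bar.ι k A d)
    (Bar.mem_cocycles (by rw [LinearMap.comp_assoc, hf, LinearMap.comp_zero]))
  map_zero' := rfl
  map_add' _ _ := rfl

/-- The action on `𝒟` is right multiplication by `flip` of the scalar, and `flip` is an involution.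
-/
theorem smul_dualClass {Y : Type*} [AddCommGroup Y] [Module (Env k A) Y]
    (f : Bar k A d →ₗ[Env k A] Y) (hf : f ∘ₗ Bar.d k A d = 0) (u : Env k A)
    (q : Y →ₗ[Env k A] Env k A) :
    Env.flip k A u • dualClass f hf q =
      dualClass f hf (LinearMap.toSpanSingleton (Env k A) (Env k A) u ∘ₗ q) := by
  have : u = Env.flip k A (Env.flip k A u) := (Env.flip_flip k A u).symm
  conv_rhs => rw [this]
  rfl

theorem dualClass_eq_zero {Y : Type*} [AddCommGroup Y] [Module (Env k A) Y]
    {f : Bar k A d →ₗ[Env k A] Y} (hf : f ∘ₗ Bar.d k A d = 0) {q : Y →ₗ[Env k A] Env k A}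
    (h : (q ∘ₗ f).restrictScalars k ∘ₗ Bar.ι k A d ∈ coboundaries k A (Env k A) d) :
    dualClass f hf q = 0 :=
  cohomologyClass_eq_zero_iff.2 h

namespace FiniteModel

variable (X : FiniteModel k A d)

/-- The image of `δ d` is a direct summand of `X d`: the vanishing condition, applied to `δ d` as a
map onto its image, gives a retraction `ψ`. Projectivity of `X d` lifts `ψ` to `κ` with `δ ∘ κ = ψ`,
and `(1 - δ ∘ κ) ∘ f` kills the image of the bar differential. -/
theorem exists_truncation (X : FiniteModel k A d) : ∃ l : Bar k A d →ₗ[Env k A] X.X (d + 1),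
    (X.f d + X.δ d ∘ₗ l) ∘ₗ Bar.d k A d = 0 := by
  have h (x) : X.δ d (X.δ (d + 1) x) = 0 := LinearMap.congr_fun (X.δ_comp_δ d) x
  obtain ⟨ψ, hψ⟩ := X.vanishing d le_rfl (ModuleCat.of _ (LinearMap.range (X.δ d)))
    (X.δ d).rangeRestrict (LinearMap.ext fun x ↦ Subtype.ext (h x))
  obtain ⟨κ, hκ⟩ := Module.projective_lifting_property (X.δ d).rangeRestrict ψ
    (LinearMap.surjective_rangeRestrict _)
  refine ⟨-(κ ∘ₗ X.f d), LinearMap.ext fun b ↦ ?_⟩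
  have h₁ : X.δ d (κ (X.f d (Bar.d k A d b))) = X.f d (Bar.d k A d b) := by
    rw [X.f_comp_d_apply]
    have h₂ := congrArg Subtype.val (LinearMap.congr_fun hκ (X.δ d (X.f (d + 1) b)))
    have h₃ := congrArg Subtype.val (LinearMap.congr_fun hψ (X.f (d + 1) b))
    exact h₂.trans h₃
  simp [h₁]

variable {l : Bar k A d →ₗ[Env k A] X.X (d + 1)}

theorem g_comp_truncation (l : Bar k A d →ₗ[Env k A] X.X (d + 1)) :
    X.g d ∘ₗ (X.f d + X.δ d ∘ₗ l) = X.g d ∘ₗ X.f d + Bar.d k A d ∘ₗ (X.g (d + 1) ∘ₗ l) := by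
  rw [LinearMap.comp_add, ← LinearMap.comp_assoc, ← X.d_comp_g, LinearMap.comp_assoc]

/-- The truncated comparison map, followed by `g`, differs from the identity by homotopy terms only;
tensored with `N` it therefore fixes every homology class in degree `d`. -/
theorem mapChain_sub_mem_boundaries {N : Type*} [AddCommGroup N] [Module k N] [Module (Env k A) N]
    [IsScalarTower k (Env k A) N] (l : Bar k A d →ₗ[Env k A] X.X (d + 1)) {z : Chain k A N d}
    (hz : z ∈ cycles k A N d) :
    Bar.mapChain N (X.g d ∘ₗ (X.f d + X.δ d ∘ₗ l)) z - z ∈ boundaries k A N d := by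
  rw [X.g_comp_truncation]
  have hb (w) : boundary k A N d w ∈ boundaries k A N d := ⟨w, rfl⟩
  cases d with
  | zero =>
    rw [X.g_comp_f_zero]
    simp only [Bar.mapChain_add, Bar.mapChain_comp, Bar.mapChain_d, Bar.mapChain_id,
      LinearMap.add_apply, LinearMap.comp_apply, LinearMap.id_apply]
    rw [add_sub_right_comm, add_sub_cancel_right]
    exact Submodule.add_mem _ (hb _) (hb _)
  | succ d =>
    rw [mem_cycles_succ] at hz
    rw [X.g_comp_f_succ]
    simp only [Bar.mapChain_add, Bar.mapChain_comp, Bar.mapChain_d, Bar.mapChain_id,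
      LinearMap.add_apply, LinearMap.comp_apply, LinearMap.id_apply, hz, map_zero, zero_add]
    rw [add_sub_right_comm, add_sub_cancel_right]
    exact Submodule.add_mem _ (hb _) (hb _)

/-- A cycle in degree `d` that is annihilated by all cocycles with values in `Aᵉ` is a boundary. -/
theorem mem_boundaries_of_evalChain {N : Type*} [AddCommGroup N] [Module k N] [Module (Env k A) N]
    [IsScalarTower k (Env k A) N] (X : FiniteModel k A d) {z : Chain k A N d}
    (hz : z ∈ cycles k A N d)
    (h : ∀ f ∈ cocycles k A (Env k A) d,
      evalChain k A N (capChain (Nat.add_zero d) z f) = 0) : z ∈ boundaries k A N d := by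
  obtain ⟨l, hl⟩ := X.exists_truncation
  obtain ⟨n, p, p', hp⟩ := exists_dualBasis (Env k A) (X.X d)
  set f' := X.f d + X.δ d ∘ₗ l with hf'
  -- Expanding `f'` in the dual basis expresses `g ∘ f'` on chains through the caps with the
  -- cochains `p' i ∘ f'`. These are cocycles because `f'` kills boundaries.
  have key (w : Chain k A N d) : Bar.mapChain N (X.g d ∘ₗ f') w = (-1 : k) ^ (d * d) • ∑ i,
      Bar.toChain (evalChain k A N (capChain (Nat.add_zero d) w
        ((p' i ∘ₗ f').restrictScalars k ∘ₗ Bar.ι k A d))) (X.g d (p i)) := by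
    induction w using TensorProduct.induction_on with
    | zero => simp [Bar.toChain_zero_left]
    | add x y hx hy =>
      simp only [map_add, LinearMap.add_apply, Bar.toChain_add_left, Finset.sum_add_distrib,
        smul_add, hx, hy]
    | tmul ν t =>
      rw [Bar.mapChain_tmul, LinearMap.comp_apply]
      conv_lhs => rw [← hp (f' (Bar.ι k A d t)), map_sum, map_sum]
      rw [Finset.smul_sum]
      refine Finset.sum_congr rfl fun i _ ↦ ?_
      rw [evalChain_capChain, map_smul, Bar.toChain_smul]
      have hs (c : k) (x : N) (b : Bar k A d) : Bar.toChain (c • x) b = c • Bar.toChain x b := by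
        have : c • x = Env.flip k A (c • 1) • x := by
          rw [map_smul, Env.flip_one, smul_assoc, one_smul]
        rw [this, ← Bar.toChain_smul, smul_assoc, one_smul, map_smul]
      rw [hs, smul_smul, ← mul_pow]
      simp
  have h₀ : Bar.mapChain N (X.g d ∘ₗ f') z = 0 := by
    rw [key]
    refine (congrArg _ (Finset.sum_eq_zero fun i _ ↦ ?_)).trans (smul_zero _)
    rw [h _ (Bar.mem_cocycles (by rw [LinearMap.comp_assoc, hl, LinearMap.comp_zero])),
      Bar.toChain_zero_left]
  have := X.mapChain_sub_mem_boundaries l hz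
  rw [← hf', h₀, zero_sub] at this
  exact neg_mem_iff.1 this

/-- The dual basis expansion `q = ∑ p' i · q (p i)` of a functional, passed to classes in `𝒟`. -/
theorem sum_smul_dualClass {Y : Type*} [AddCommGroup Y] [Module (Env k A) Y]
    {f : Bar k A d →ₗ[Env k A] Y} (hf : f ∘ₗ Bar.d k A d = 0) {n : ℕ} {p : Fin n → Y}
    {p' : Fin n → Y →ₗ[Env k A] Env k A} (hp : ∀ x, ∑ i, p' i x • p i = x)
    (q : Y →ₗ[Env k A] Env k A) :
    ∑ i, Env.flip k A (q (p i)) • dualClass f hf (p' i) = dualClass f hf q := by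
  simp only [smul_dualClass, ← map_sum]
  congr 1
  refine LinearMap.ext fun x ↦ ?_
  conv_rhs => rw [← hp x, map_sum]
  simp [LinearMap.sum_apply]

/-- The cycle is the canonical element of `𝒟 ⊗_{Aᵉ} X d` attached to the dual basis, carried to
Hochschild chains by `g`. It reproduces each class by `sum_smul_dualClass`. -/
theorem exists_cycle (X : FiniteModel k A d) : ∃ z ∈ cycles k A (Dualizing k A d) d,
    ∀ (f : Cochain k A (Env k A) d) (hf : f ∈ cocycles k A (Env k A) d),
      evalChain k A (Dualizing k A d) (capChain (Nat.add_zero d) z f) =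
        cohomologyClass f hf := by
  obtain ⟨l, hl⟩ := X.exists_truncation
  obtain ⟨n, p, p', hp⟩ := exists_dualBasis (Env k A) (X.X d)
  set f' := X.f d + X.δ d ∘ₗ l with hf'
  let z₀ : Chain k A (Dualizing k A d) d :=
    ∑ i, Bar.toChain (dualClass f' hl (p' i)) (X.g d (p i))
  have hz₀ : z₀ ∈ cycles k A (Dualizing k A d) d := by
    cases d with
    | zero => trivial
    | succ d =>
      rw [mem_cycles_succ]
      -- A second dual basis, one degree lower, regroups the boundary so that the coefficient of `y
      -- j` is the class of `y' j ∘ δ`.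
      obtain ⟨m, y, y', hy⟩ := exists_dualBasis (Env k A) (X.X d)
      have h₁ (i) : boundary k A (Dualizing k A (d + 1)) d
          (Bar.toChain (dualClass f' hl (p' i)) (X.g (d + 1) (p i))) =
          ∑ j, Bar.toChain (Env.flip k A (y' j (X.δ d (p i))) • dualClass f' hl (p' i))
            (X.g d (y j)) := by
        rw [Bar.boundary_toChain, X.d_comp_g_apply]
        conv_lhs => rw [← hy (X.δ d (p i)), map_sum, map_sum]
        exact Finset.sum_congr rfl fun j _ ↦ by rw [map_smul, Bar.toChain_smul]
      simp only [z₀, map_sum, h₁]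
      rw [Finset.sum_comm]
      refine Finset.sum_eq_zero fun j _ ↦ ?_
      have h₂ := sum_smul_dualClass hl hp (y' j ∘ₗ X.δ d)
      simp only [LinearMap.comp_apply] at h₂
      rw [← Bar.toChain_sum_left, h₂]
      -- The correction in `f'` dies under `δ ∘ δ = 0`, and `f` is a chain map; so the functional
      -- pulls back to a coboundary.
      have h₃ : (y' j ∘ₗ X.δ d) ∘ₗ f' = (y' j ∘ₗ X.f d) ∘ₗ Bar.d k A d := by
        have := X.δ_comp_δ d
        rw [LinearMap.comp_assoc (Bar.d k A d), X.f_comp_d, hf', LinearMap.comp_assoc,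
          LinearMap.comp_add, ← LinearMap.comp_assoc l, this, LinearMap.zero_comp, add_zero]
      rw [dualClass_eq_zero hl (by rw [h₃]; exact Bar.mem_coboundaries _), Bar.toChain_zero_left]
  -- The factor cancels the sign of the cap product for `r = p = d`.
  refine ⟨(-1 : k) ^ (d * d) • z₀, Submodule.smul_mem _ _ hz₀, fun f hf ↦ ?_⟩
  have hφ := Bar.lift_comp_d_eq_zero hf
  have h₁ : evalChain k A (Dualizing k A d) (capChain (Nat.add_zero d) z₀ f) =
      (-1 : k) ^ (d * d) • dualClass f' hl (Bar.lift f ∘ₗ X.g d) := by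
    rw [← sum_smul_dualClass hl hp]
    simp only [z₀, map_sum, LinearMap.sum_apply, Finset.smul_sum]
    refine Finset.sum_congr rfl fun i _ ↦ ?_
    have := evalChain_capChain_toChain (dualClass f' hl (p' i)) (X.g d (p i)) (Bar.lift f)
    rwa [Bar.lift_comp_ι] at this
  rw [map_smul, LinearMap.smul_apply, map_smul, h₁, smul_smul, ← mul_pow]
  simp only [mul_neg, mul_one, neg_neg, one_pow, one_smul]
  refine cohomologyClass_eq_iff.2 ?_
  change ((Bar.lift f ∘ₗ X.g d) ∘ₗ f').restrictScalars k ∘ₗ Bar.ι k A d - f ∈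
    coboundaries k A (Env k A) d
  have h₂ : (Bar.lift f ∘ₗ X.g d) ∘ₗ f' = Bar.lift f ∘ₗ X.g d ∘ₗ X.f d := by
    rw [LinearMap.comp_assoc, hf', X.g_comp_truncation, LinearMap.comp_add,
      ← LinearMap.comp_assoc _ (Bar.d k A d), hφ, LinearMap.zero_comp, add_zero]
  have h₃ := X.comp_sub_mem_coboundaries hφ
  rwa [Bar.lift_comp_ι, ← h₂] at h₃

theorem existsUnique_fundamentalClass (X : FiniteModel k A d) :
    ∃! c : Homology k A (Dualizing k A d) d, IsFundamentalClass c := by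
  obtain ⟨z, hz, h⟩ := X.exists_cycle
  refine ⟨Submodule.Quotient.mk ⟨z, hz⟩, fun α ↦ ?_, fun c hc ↦ ?_⟩
  · obtain ⟨f, hf, rfl⟩ := exists_cohomologyClass_eq α
    exact h f hf
  · obtain ⟨w, rfl⟩ := Submodule.Quotient.mk_surjective _ c
    refine (Submodule.Quotient.eq _).2 ?_
    change w.1 - z ∈ boundaries k A _ d
    refine X.mem_boundaries_of_evalChain (Submodule.sub_mem _ w.2 hz) fun f hf ↦ ?_
    have h₁ : evalChain k A (Dualizing k A d) (capChain (Nat.add_zero d) w.1 f) =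
        cohomologyClass f hf := hc (cohomologyClass f hf)
    rw [map_sub, LinearMap.sub_apply, map_sub, h₁]
    exact sub_eq_zero.2 (h f hf).symm

end FiniteModel

end FundamentalClass

/-! ### Capping with a cycle as a map of complexes. -/

section Complexes

variable {k A : Type*} [Field k] [Ring A] [Algebra k A]
variable {M : Type*} [AddCommGroup M] [Module k M] [Module (Env k A) M]
  [IsScalarTower k (Env k A) M]

theorem boundary_boundary (n : ℕ) (z : Chain k A M (n + 2)) :
    boundary k A M n (boundary k A M (n + 1) z) = 0 := by
  rw [← Bar.mapChain_d, ← Bar.mapChain_d, ← LinearMap.comp_apply, ← Bar.mapChain_comp,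
    Bar.d_comp_d, Bar.mapChain_zero, LinearMap.zero_apply]

theorem boundary_mem_cycles (n : ℕ) (z : Chain k A M (n + 1)) :
    boundary k A M n z ∈ cycles k A M n := by
  cases n with
  | zero => trivial
  | succ n => exact boundary_boundary n z

theorem coboundary_coboundary (n : ℕ) (f : Cochain k A M n) :
    coboundary k A M (n + 1) (coboundary k A M n f) = 0 := by
  have h := Bar.comp_d (Bar.lift f)
  rw [Bar.lift_comp_ι] at h
  rw [← h, ← Bar.comp_d, LinearMap.comp_assoc, Bar.d_comp_d, LinearMap.comp_zero]
  rfl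

theorem homologyClass_eq_zero_iff {n : ℕ} {z : Chain k A M n} {hz : z ∈ cycles k A M n} :
    (Submodule.Quotient.mk ⟨z, hz⟩ : Homology k A M n) = 0 ↔ z ∈ boundaries k A M n :=
  Submodule.Quotient.mk_eq_zero _

variable {N : Type*} [AddCommGroup N] [Module k N] [Module (Env k A) N]
  [IsScalarTower k (Env k A) N]

/-- The Leibniz rule without its cycle term: capping with a cycle commutes with the differentials up
to sign, hence with connecting maps. -/
theorem boundary_capChain_of_mem_cycles {p q d : ℕ} (h₁ : p + 1 + q = d) (h₂ : p + (q + 1) = d)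
    {z : Chain k A N d} (hz : z ∈ cycles k A N d) (f : Cochain k A M p) :
    boundary k A (BTensor k A N M) q (capChain h₂ z f) =
      (-1 : k) ^ q • capChain h₁ z (coboundary k A M p f) := by
  obtain ⟨r, rfl⟩ : ∃ r, d = r + 1 := ⟨p + q, by omega⟩
  rw [mem_cycles_succ] at hz
  have := capChain_leibniz (by omega) h₁ h₂ z f
  rw [hz, map_zero, LinearMap.zero_apply, pow_succ, mul_neg, mul_one, neg_smul] at this
  exact (neg_add_eq_zero.1 this.symm).symm

/-- Injectivity of the cap product with a cycle, on cohomology. -/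
def CapInjective {p q r : ℕ} (h : p + q = r) (z : Chain k A N r) (M : Type*) [AddCommGroup M]
    [Module k M] [Module (Env k A) M] [IsScalarTower k (Env k A) M] : Prop :=
  ∀ f ∈ cocycles k A M p, capChain h z f ∈ boundaries k A (BTensor k A N M) q →
    f ∈ coboundaries k A M p

/-- Surjectivity of the cap product with a cycle, on homology. -/
def CapSurjective {p q r : ℕ} (h : p + q = r) (z : Chain k A N r) (M : Type*) [AddCommGroup M]
    [Module k M] [Module (Env k A) M] [IsScalarTower k (Env k A) M] : Prop :=
  ∀ y ∈ cycles k A (BTensor k A N M) q, ∃ f ∈ cocycles k A M p,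
    capChain h z f - y ∈ boundaries k A (BTensor k A N M) q

theorem cap_bijective {p q r : ℕ} (h : p + q = r) {z : Chain k A N r} (hz : z ∈ cycles k A N r)
    (hi : CapInjective h z M) (hs : CapSurjective h z M) :
    Function.Bijective (cap h (Submodule.Quotient.mk ⟨z, hz⟩) :
      Cohomology k A M p →ₗ[k] Homology k A (BTensor k A N M) q) := by
  constructor
  · refine (injective_iff_map_eq_zero _).2 fun α hα ↦ ?_
    obtain ⟨f, hf, rfl⟩ := exists_cohomologyClass_eq α
    have h₀ : (Submodule.Quotient.mk ⟨capChain h z f, capChain_mem_cycles h hz hf⟩ :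
        Homology k A (BTensor k A N M) q) = 0 := hα
    have h₁ : capChain h z f ∈ boundaries k A (BTensor k A N M) q :=
      homologyClass_eq_zero_iff.1 h₀
    exact cohomologyClass_eq_zero_iff.2 (hi f hf h₁)
  · intro y
    obtain ⟨y, rfl⟩ := Submodule.Quotient.mk_surjective _ y
    obtain ⟨f, hf, hfy⟩ := hs y.1 y.2
    exact ⟨cohomologyClass f hf, (Submodule.Quotient.eq _).2 hfy⟩

end Complexes

/-! ### Diagram chases along a short exact sequence of coefficients. -/

section DimensionShift

variable {k A : Type*} [Field k] [Ring A] [Algebra k A]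
variable {K F M N : Type*}
  [AddCommGroup K] [Module k K] [Module (Env k A) K] [IsScalarTower k (Env k A) K]
  [AddCommGroup F] [Module k F] [Module (Env k A) F] [IsScalarTower k (Env k A) F]
  [AddCommGroup M] [Module k M] [Module (Env k A) M] [IsScalarTower k (Env k A) M]
  [AddCommGroup N] [Module k N] [Module (Env k A) N]
  [IsScalarTower k (Env k A) N]
  {i : K →ₗ[Env k A] F} {π : F →ₗ[Env k A] M}

theorem exists_cochain_lift (hπ : Function.Surjective π) {p : ℕ} (f : Cochain k A M p) :
    ∃ g : Cochain k A F p, π.restrictScalars k ∘ₗ g = f := by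
  obtain ⟨s, hs⟩ := (π.restrictScalars k).exists_rightInverse_of_surjective
    (LinearMap.range_eq_top.2 hπ)
  exact ⟨s ∘ₗ f, by rw [← LinearMap.comp_assoc, hs, LinearMap.id_comp]⟩

theorem exists_cochain_factor (hi : Function.Injective i) (hex : Function.Exact i π) {p : ℕ}
    {f : Cochain k A F p} (hf : π.restrictScalars k ∘ₗ f = 0) :
    ∃ g : Cochain k A K p, i.restrictScalars k ∘ₗ g = f := by
  obtain ⟨s, hs⟩ := (i.restrictScalars k).exists_leftInverse_of_injective
    (LinearMap.ker_eq_bot.2 hi)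
  refine ⟨s ∘ₗ f, LinearMap.ext fun t ↦ ?_⟩
  obtain ⟨x, hx⟩ := (hex (f t)).1 (LinearMap.congr_fun hf t)
  have := LinearMap.congr_fun hs x
  simp only [LinearMap.comp_apply, LinearMap.coe_restrictScalars, LinearMap.id_apply,
    ← hx] at this ⊢
  rw [this]

theorem mem_cocycles_of_injective (hi : Function.Injective i) {p : ℕ} {f : Cochain k A K p}
    (hf : i.restrictScalars k ∘ₗ f ∈ cocycles k A F p) : f ∈ cocycles k A K p := by
  have hf' : coboundary k A F p (i.restrictScalars k ∘ₗ f) = 0 := hf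
  rw [coboundary_comp] at hf'
  exact LinearMap.ext fun t ↦ hi ((LinearMap.congr_fun hf' t).trans (map_zero i).symm)

theorem mem_cycles_of_injective (hi : Function.Injective i) {q : ℕ} {z : Chain k A K q}
    (hz : Chain.map k A i q z ∈ cycles k A F q) : z ∈ cycles k A K q := by
  cases q with
  | zero => trivial
  | succ q =>
    rw [mem_cycles_succ, boundary_map] at hz
    exact Chain.map_injective hi q (hz.trans (map_zero _).symm)

/-- The connecting map `H^p(M) → H^{p+1}(K)` on cochains. Lifting and factoring cochains is possible
because the sequence splits over the field `k`. -/
theorem exists_coboundary_lift (hi : Function.Injective i) (hex : Function.Exact i π)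
    (hπ : Function.Surjective π) {p : ℕ} {f : Cochain k A M p} (hf : f ∈ cocycles k A M p) :
    ∃ (g : Cochain k A F p) (c : Cochain k A K (p + 1)), π.restrictScalars k ∘ₗ g = f ∧
      i.restrictScalars k ∘ₗ c = coboundary k A F p g ∧ c ∈ cocycles k A K (p + 1) := by
  obtain ⟨g, rfl⟩ := exists_cochain_lift hπ f
  have hf' : coboundary k A M p (π.restrictScalars k ∘ₗ g) = 0 := hf
  rw [coboundary_comp] at hf'
  obtain ⟨c, hc⟩ := exists_cochain_factor hi hex hf'
  refine ⟨g, c, rfl, hc, mem_cocycles_of_injective hi ?_⟩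
  rw [hc]
  exact coboundary_coboundary p g

variable {d : ℕ} {z : Chain k A N d}

/-- As `H^p(F) = 0`, the connecting map is injective on `H^p(M)`; capping carries it, up to sign, to
the connecting map in homology, and injectivity for `K` concludes. -/
theorem capInjective_step (hi : Function.Injective i) (hex : Function.Exact i π)
    (hπ : Function.Surjective π) (hNi : Function.Injective (BTensor.map N i))
    (hz : z ∈ cycles k A N d) {p q : ℕ} (h₁ : p + 1 + q = d) (h₂ : p + (q + 1) = d)
    (hK : CapInjective h₁ z K) (hF : ∀ f ∈ cocycles k A F p, f ∈ coboundaries k A F p) :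
    CapInjective h₂ z M := by
  rintro f hf ⟨y, hy⟩
  obtain ⟨g, c, rfl, hc, hc'⟩ := exists_coboundary_lift hi hex hπ hf
  obtain ⟨y, rfl⟩ := Chain.map_surjective (BTensor.map_surjective (N := N) hπ) _ y
  rw [boundary_map, capChain_map] at hy
  obtain ⟨w, hw⟩ := ((Chain.map_exact (BTensor.map_exact (N := N) hex hπ)
    (BTensor.map_surjective hπ) (q + 1)) (capChain h₂ z g - boundary k A _ (q + 1) y)).1
    (by rw [map_sub, hy, sub_self])
  -- The cap with the connecting cocycle `c` bounds, because `z ∩ g` differs from the boundary of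
  -- `y` only by the chain `w` from `K`.
  have hbw : boundary k A _ q w = (-1 : k) ^ q • capChain h₁ z c := by
    apply Chain.map_injective hNi
    rw [← boundary_map, hw, map_sub, boundary_boundary, sub_zero,
      boundary_capChain_of_mem_cycles h₁ h₂ hz, ← hc, capChain_map, map_smul]
  have hcb : c ∈ coboundaries k A K (p + 1) := by
    refine hK c hc' ⟨(-1 : k) ^ q • w, ?_⟩
    rw [map_smul, hbw, smul_smul, ← mul_pow]
    simp
  obtain ⟨χ, rfl⟩ := hcb
  have hg : g - i.restrictScalars k ∘ₗ χ ∈ coboundaries k A F p := by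
    refine hF _ ?_
    change coboundary k A F p _ = 0
    rw [map_sub, ← hc, coboundary_comp, sub_self]
  have := map_mem_coboundaries π hg
  rwa [LinearMap.comp_sub, ← LinearMap.comp_assoc _ (i.restrictScalars k), sub_eq_self.2] at this
  refine LinearMap.ext fun t ↦ hex.apply_apply_eq_zero _

/-- A four-lemma chase: the connecting class of `y` is a cap with some `c` over `K`. Injectivity for
`F` makes `c` bound in `F`, and a cochain `g` bounding it descends to the required cocycle over `M`.
-/
theorem capSurjective_step (hex : Function.Exact i π)
    (hπ : Function.Surjective π) (hNi : Function.Injective (BTensor.map N i))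
    (hz : z ∈ cycles k A N d) {p q : ℕ} (h₁ : p + 1 + q = d) (h₂ : p + (q + 1) = d)
    (hK : CapSurjective h₁ z K) (hF : CapInjective h₁ z F)
    (hF' : ∀ y ∈ cycles k A (BTensor k A N F) (q + 1), y ∈ boundaries k A _ (q + 1)) :
    CapSurjective h₂ z M := by
  intro y hy
  rw [mem_cycles_succ] at hy
  obtain ⟨y, rfl⟩ := Chain.map_surjective (BTensor.map_surjective (N := N) hπ) _ y
  rw [boundary_map] at hy
  obtain ⟨w, hw⟩ := ((Chain.map_exact (BTensor.map_exact (N := N) hex hπ)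
    (BTensor.map_surjective hπ) q) (boundary k A _ q y)).1 hy
  have hw' : w ∈ cycles k A _ q :=
    mem_cycles_of_injective hNi (by rw [hw]; exact boundary_mem_cycles q y)
  obtain ⟨c, hc, v, hv⟩ := hK w hw'
  have hic : i.restrictScalars k ∘ₗ c ∈ coboundaries k A F (p + 1) := by
    refine hF _ (map_mem_cocycles i hc) ⟨y + Chain.map k A (BTensor.map N i) (q + 1) v, ?_⟩
    rw [capChain_map, map_add, boundary_map, hv, map_sub, hw]
    abel
  obtain ⟨g, hg⟩ := hic
  -- The sign from the Leibniz rule makes the two boundaries agree, so the difference is a cycle and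
  -- bounds by the vanishing of the homology of `N ⊗_A F`.
  have hg' : (-1 : k) ^ q • capChain h₂ z g -
      (y + Chain.map k A (BTensor.map N i) (q + 1) v) ∈ boundaries k A _ (q + 1) := by
    refine hF' _ ?_
    rw [mem_cycles_succ, map_sub, map_smul, boundary_capChain_of_mem_cycles h₁ h₂ hz, hg,
      smul_smul, ← mul_pow, capChain_map, map_add, boundary_map, hv, map_sub, hw]
    simp
  refine ⟨(-1 : k) ^ q • π.restrictScalars k ∘ₗ g, Submodule.smul_mem _ _ ?_, ?_⟩
  · change coboundary k A M p _ = 0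
    rw [coboundary_comp, hg]
    exact LinearMap.ext fun t ↦ hex.apply_apply_eq_zero _
  · have := Chain.map_mem_boundaries (BTensor.map N π) hg'
    rw [map_sub, map_add, map_smul, ← capChain_map,
      (Chain.map_exact (BTensor.map_exact (N := N) hex hπ)
        (BTensor.map_surjective hπ) (q + 1)).apply_apply_eq_zero, add_zero] at this
    rwa [map_smul]

/-- A four-lemma chase at the right end of the sequences. Vanishing of `H^{p+1}(K)` lifts a cocycle
from `M` to a cocycle over `F`; surjectivity for `K` then corrects this lift until its cap bounds.
Left exactness of `N ⊗_A -` is not needed. -/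
theorem capInjective_zero (hi : Function.Injective i) (hex : Function.Exact i π)
    (hπ : Function.Surjective π) {p : ℕ} (h : p + 0 = d)
    (hK : CapSurjective h z K) (hF : CapInjective h z F)
    (hK' : ∀ f ∈ cocycles k A K (p + 1), f ∈ coboundaries k A K (p + 1)) :
    CapInjective h z M := by
  rintro f hf ⟨y, hy⟩
  obtain ⟨g, c, rfl, hc, hc'⟩ := exists_coboundary_lift hi hex hπ hf
  obtain ⟨χ, rfl⟩ := hK' c hc'
  have hπi (f : Cochain k A K p) :
      π.restrictScalars k ∘ₗ i.restrictScalars k ∘ₗ f = 0 :=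
    LinearMap.ext fun t ↦ hex.apply_apply_eq_zero _
  have hg : g - i.restrictScalars k ∘ₗ χ ∈ cocycles k A F p := by
    change coboundary k A F p _ = 0
    rw [map_sub, ← hc, coboundary_comp, sub_self]
  obtain ⟨g', hg', hgg⟩ : ∃ g' ∈ cocycles k A F p,
      π.restrictScalars k ∘ₗ g' = π.restrictScalars k ∘ₗ g :=
    ⟨_, hg, by rw [LinearMap.comp_sub, hπi, sub_zero]⟩
  rw [← hgg] at hy ⊢
  obtain ⟨y, rfl⟩ := Chain.map_surjective (BTensor.map_surjective (N := N) hπ) _ y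
  rw [boundary_map, capChain_map] at hy
  obtain ⟨w, hw⟩ := ((Chain.map_exact (BTensor.map_exact (N := N) hex hπ)
    (BTensor.map_surjective hπ) 0) (capChain h z g' - boundary k A _ 0 y)).1
    (by rw [map_sub, hy, sub_self])
  -- Every chain of degree `0` is a cycle, so surjectivity applies to `w` directly.
  obtain ⟨c, hc, v, hv⟩ := hK w trivial
  have hgc : g' - i.restrictScalars k ∘ₗ c ∈ coboundaries k A F p := by
    refine hF _ (Submodule.sub_mem _ hg' (map_mem_cocycles i hc))
      ⟨y - Chain.map k A (BTensor.map N i) 1 v, ?_⟩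
    rw [map_sub, map_sub, capChain_map, boundary_map, hv, map_sub, hw]
    abel
  have := map_mem_coboundaries π hgc
  rwa [LinearMap.comp_sub, hπi, sub_zero] at this

theorem capSurjective_zero (hπ : Function.Surjective π) {p : ℕ} (h : p + 0 = d)
    (hF : CapSurjective h z F) : CapSurjective h z M := by
  intro y _
  obtain ⟨y, rfl⟩ := Chain.map_surjective (BTensor.map_surjective (N := N) hπ) _ y
  obtain ⟨f, hf, hfy⟩ := hF y trivial
  refine ⟨_, map_mem_cocycles π hf, ?_⟩
  have := Chain.map_mem_boundaries (BTensor.map N π) hfy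
  rwa [map_sub, ← capChain_map] at this

end DimensionShift

/-! ### Free presentations of bimodules. -/

section FreeCover

variable {k A : Type u} [Field k] [Ring A] [Algebra k A]

theorem exists_kernel {F M : Type u} [AddCommGroup F] [Module k F] [Module (Env k A) F]
    [IsScalarTower k (Env k A) F] [AddCommGroup M] [Module (Env k A) M] (π : F →ₗ[Env k A] M) :
    ∃ (K : Type u) (_ : AddCommGroup K) (_ : Module k K) (_ : Module (Env k A) K)
      (_ : IsScalarTower k (Env k A) K) (i : K →ₗ[Env k A] F),
      Function.Injective i ∧ Function.Exact i π :=
  ⟨LinearMap.ker π, inferInstance, inferInstance, inferInstance, inferInstance,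
    (LinearMap.ker π).subtype, Subtype.val_injective, LinearMap.exact_subtype_ker_map π⟩

variable (k A) in
/-- Every bimodule is a quotient of a free one. -/
theorem exists_free_presentation (M : Type u) [AddCommGroup M] [Module k M] [Module (Env k A) M]
    [IsScalarTower k (Env k A) M] :
    ∃ (K F : Type u) (_ : AddCommGroup K) (_ : Module k K) (_ : Module (Env k A) K)
      (_ : IsScalarTower k (Env k A) K) (_ : AddCommGroup F) (_ : Module k F)
      (_ : Module (Env k A) F) (_ : IsScalarTower k (Env k A) F)
      (_ : FreeCoordinates k A M F) (i : K →ₗ[Env k A] F) (π : F →ₗ[Env k A] M),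
      Function.Injective i ∧ Function.Exact i π ∧ Function.Surjective π := by
  obtain ⟨K, _, _, _, _, i, hi, hex⟩ := exists_kernel (k := k) (A := A) (F := M →₀ Env k A)
    (M := M)
    (Finsupp.linearCombination (Env k A) (id : M → M))
  exact ⟨K, M →₀ Env k A, _, _, _, inferInstance, _, _, _, inferInstance,
    FreeCoordinates.finsupp k A M, i, _, hi, hex, Finsupp.linearCombination_id_surjective _ _⟩

end FreeCover

/-! ### The cap product with free coefficients. -/

section Free

variable {k A : Type u} [Field k] [Ring A] [Algebra k A] {d : ℕ}
variable {ι F : Type*} [AddCommGroup F] [Module k F] [Module (Env k A) F]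
  [IsScalarTower k (Env k A) F]
variable {N : Type*} [AddCommGroup N] [Module k N] [Module (Env k A) N]
  [IsScalarTower k (Env k A) N]

/-- Up to a coboundary the cocycle has only finitely many nonzero coordinates, so cochains bounding
these can be summed even when `F` has infinite rank. -/
theorem mem_coboundaries_of_coord (e : FreeCoordinates k A ι F) (X : FiniteModel k A d)
    {p : ℕ} {f : Cochain k A F p} (hf : f ∈ cocycles k A F p)
    (h : ∀ j, (e.coord j).restrictScalars k ∘ₗ f ∈ coboundaries k A (Env k A) p) :
    f ∈ coboundaries k A F p := by
  classical
  obtain ⟨J, hJ⟩ := X.exists_finset_sub_mem_coboundaries e hf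
  exact (Submodule.sub_mem_iff_left _
    (Submodule.sum_mem _ fun j _ ↦ map_mem_coboundaries (e.incl j) (h j))).1 hJ

theorem CapInjective.of_free (e : FreeCoordinates k A ι F) (X : FiniteModel k A d)
    {p q r : ℕ} {h : p + q = r} {z : Chain k A N r}
    (hz : CapInjective h z (Env k A)) : CapInjective h z F := fun f hf hb ↦
  mem_coboundaries_of_coord e X hf fun j ↦ hz _ (map_mem_cocycles _ hf) (by
    rw [capChain_map]
    exact Chain.map_mem_boundaries _ hb)

theorem CapSurjective.of_free (e : FreeCoordinates k A ι F)
    {p q r : ℕ} {h : p + q = r} {z : Chain k A N r}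
    (hz : CapSurjective h z (Env k A)) : CapSurjective h z F := by
  classical
  intro y hy
  obtain ⟨J, hJ⟩ := Chain.exists_finset_eq_sum e y
  choose f hf hfy using fun j ↦ hz _ (Chain.map_mem_cycles (BTensor.map N (e.coord j)) hy)
  refine ⟨∑ j ∈ J, (e.incl j).restrictScalars k ∘ₗ f j,
    Submodule.sum_mem _ fun j _ ↦ map_mem_cocycles _ (hf j), ?_⟩
  rw [hJ J subset_rfl, map_sum, ← Finset.sum_sub_distrib]
  refine Submodule.sum_mem _ fun j _ ↦ ?_
  rw [capChain_map, ← map_sub]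
  exact Chain.map_mem_boundaries _ (hfy j)

end Free

/-! ### The duality isomorphism, by induction on homological degree. -/

section Duality

variable {k A : Type u} [Field k] [Ring A] [Algebra k A] {d : ℕ}

theorem capInjective_env {z : Chain k A (Dualizing k A d) d}
    (hz : ∀ (f : Cochain k A (Env k A) d) (hf : f ∈ cocycles k A (Env k A) d),
      evalChain k A (Dualizing k A d) (capChain (Nat.add_zero d) z f) = cohomologyClass f hf) :
    CapInjective (Nat.add_zero d) z (Env k A) := by
  rintro f hf ⟨w, hw⟩
  refine cohomologyClass_eq_zero_iff (hf := hf).1 ((hz f hf).symm.trans ?_)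
  rw [← hw]
  exact LinearMap.congr_fun (evalChain_boundary k A _) w

/-- An element of `𝒟` is itself a cohomology class, so the value of `y` in `𝒟` supplies the cocycle;
`mem_boundaries_of_evalChain_eq_zero` says that this value determines `y` up to boundary. -/
theorem capSurjective_env {z : Chain k A (Dualizing k A d) d}
    (hz : ∀ (f : Cochain k A (Env k A) d) (hf : f ∈ cocycles k A (Env k A) d),
      evalChain k A (Dualizing k A d) (capChain (Nat.add_zero d) z f) = cohomologyClass f hf) :
    CapSurjective (Nat.add_zero d) z (Env k A) := by
  intro y _
  obtain ⟨f, hf, hfy⟩ := exists_cohomologyClass_eq (M := Env k A) (n := d)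
    (evalChain k A (Dualizing k A d) y)
  refine ⟨f, hf, mem_boundaries_of_evalChain_eq_zero ?_⟩
  rw [map_sub, hz f hf]
  exact sub_eq_zero.2 hfy

theorem cap_duality (X : FiniteModel k A d)
    (hvan : ∀ i : ℕ, i ≠ d → Subsingleton (Cohomology k A (Env k A) i))
    (hinv : IsInvertible k A (Dualizing k A d)) {z : Chain k A (Dualizing k A d) d}
    (hz : z ∈ cycles k A _ d)
    (hf : ∀ (f : Cochain k A (Env k A) d) (hf : f ∈ cocycles k A (Env k A) d),
      evalChain k A (Dualizing k A d) (capChain (Nat.add_zero d) z f) = cohomologyClass f hf)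
    (q : ℕ) : ∀ (p : ℕ) (h : p + q = d) (M : Type u) [AddCommGroup M] [Module k M]
      [Module (Env k A) M] [IsScalarTower k (Env k A) M],
      CapInjective h z M ∧ CapSurjective h z M := by
  induction q with
  | zero =>
    intro p h M _ _ _ _
    have hp : p = d := h
    subst hp
    obtain ⟨K, F, _, _, _, _, _, _, _, _, e, i, π, hi, hex, hπ⟩ :=
    exists_free_presentation k A M
    -- Surjectivity is established for all bimodules first, because injectivity for `M` uses it for
    -- the kernel `K`, which need not be free.
    have hs (M : Type u) [AddCommGroup M] [Module k M] [Module (Env k A) M]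
        [IsScalarTower k (Env k A) M] : CapSurjective h z M := by
      obtain ⟨K, F, _, _, _, _, _, _, _, _, e, i, π, hi, hex, hπ⟩ :=
    exists_free_presentation k A M
      exact capSurjective_zero hπ h ((capSurjective_env hf).of_free e)
    exact ⟨capInjective_zero hi hex hπ h (hs K) ((capInjective_env hf).of_free e X)
      fun f hf ↦ X.mem_coboundaries_of_lt (Nat.lt_succ_self _) hf, hs M⟩
  | succ q ih =>
    intro p h M _ _ _ _
    have h₁ : p + 1 + q = d := by omega
    obtain ⟨K, F, _, _, _, _, _, _, _, _, e, i, π, hi, hex, hπ⟩ :=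
    exists_free_presentation k A M
    have hNi := hinv.map_injective hi
    -- The induction hypothesis is used for both `K` and `F`. What remains is `H^p(F) = 0`, which
    -- reduces to `H^p(A, Aᵉ) = 0`, as `p < d`.
    refine ⟨capInjective_step hi hex hπ hNi hz h₁ h (ih _ h₁ K).1 fun f hf ↦ ?_,
      capSurjective_step hex hπ hNi hz h₁ h (ih _ h₁ K).2 (ih _ h₁ F).1
        fun y hy ↦ BTensor.mem_boundaries_succ_of_free e hy⟩
    have := hvan p (by omega)
    exact mem_coboundaries_of_coord e X hf fun j ↦
      cohomologyClass_eq_zero_iff (hf := map_mem_cocycles (e.coord j) hf).1 (Subsingleton.elim _ _)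

end Duality

end Hochschild

end

/-! ### Van den Bergh duality. -/

open Hochschild
theorem mainTheorem2 (k A : Type u) [Field k] [Ring A] [Algebra k A] (d : ℕ)
    (hA : HasVanDenBerghDuality k A d) :
    (∃! c : Homology k A (Dualizing k A d) d, IsFundamentalClass c) ∧
    ∀ c : Homology k A (Dualizing k A d) d, IsFundamentalClass c →
      ∀ (M : Type u) [AddCommGroup M] [Module k M] [Module (Env k A) M]
        [IsScalarTower k (Env k A) M] (p : ℕ),
        (∀ (q : ℕ) (h : p + q = d), Function.Bijective
          (cap h c : Cohomology k A M p →ₗ[k] Homology k A (BTensor k A (Dualizing k A d) M) q)) ∧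
        (d < p → Subsingleton (Cohomology k A M p)) := by
  obtain ⟨X⟩ := exists_finiteModel k A hA.typeFP hA.dimension.le
  refine ⟨X.existsUnique_fundamentalClass, fun c hc M _ _ _ _ p ↦ ⟨fun q h ↦ ?_, fun hp ↦ ?_⟩⟩
  · obtain ⟨z, rfl⟩ := Submodule.Quotient.mk_surjective _ c
    -- On a representing cycle, the defining property of `c` unfolds to the evaluation identity on
    -- cocycles, so the argument applies to any fundamental class and any representative.
    have := cap_duality X hA.vanishing hA.invertible z.2
      (fun f hf ↦ hc (cohomologyClass f hf)) q p h M
    exact cap_bijective h z.2 this.1 this.2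
  · refine ⟨fun α β ↦ ?_⟩
    obtain ⟨f, hf, rfl⟩ := exists_cohomologyClass_eq α
    obtain ⟨g, hg, rfl⟩ := exists_cohomologyClass_eq β
    exact cohomologyClass_eq_iff.2 (X.mem_coboundaries_of_lt hp (Submodule.sub_mem _ hf hg))
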